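/- All rings are commutative with unit. For an integer $m\ge 1$ and a ring $R$, let $\mathbb{W}_m(R)$ be the ring of $m$-truncated big Witt vectors: its underlying set is $\prod_{e\mid m}R$, and its ring structure is the one, functorial in $R$, for which all ghost coordinates $\mathrm{gh}_n:\mathbb{W}_m(R)\to R$, $(x_e)_{e\mid m}\mapsto\sum_{k\mid n}k\,x_k^{n/k}$ ($n\mid m$), are ring maps. For $e\mid f$ let $V_{f/e}:\mathbb{W}_e(R)\to\mathbb{W}_f(R)$ be the Verschiebung and $F_{f/e}:\mathbb{W}_f(R)\to\mathbb{W}_e(R)$ the Frobenius (functorial in $R$ and given in ghost coordinates by $(x_k)_{k\mid f}\mapsto (x_{(f/e)k})_{k\mid e}$). Write $\Phi_e(q)$ for the $e$-th cyclotomic polynomial and $[n]_t=1+t+\dots+t^{n-1}$. Let $q\text{-}\mathbb{W}_m(R)$ be the quotient of $\mathbb{W}_m(R)[q]$ by the ideal generated by $(q^e-1)\,\mathrm{im}(V_{m/e})$ for $e\mid m$ and by $\mathrm{im}\big([f/e]_{q^e}V_{m/f}-V_{m/e}\circ F_{f/e}\big)$ for $e\mid f\mid m$. For $d\ge 1$,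 let $q\text{-}\mathbb{W}_m^{(d)}(R)$ be the quotient of $\mathbb{W}_m(R)[q]$ by the ideal generated by $\big(\prod_{d\mid e'\mid e}\Phi_{e'}(q)\big)\,\mathrm{im}(V_{m/e})$ for $e\mid m$ and by $\mathrm{im}\big([f/e]_{q^e}V_{m/f}-V_{m/e}\circ F_{f/e}\big)$ for $d\mid e\mid f\mid m$. The $q$-ghost maps $$q\text{-}\mathbb{W}_m(R)\to\prod_{e\mid m}R[q]/\Phi_e(q),\qquad q\text{-}\mathbb{W}^{(d)}_m(R)\to\prod_{d\mid e\mid m}R[q]/\Phi_e(q)$$ are the maps of $\mathbb{Z}[q]$-algebras given by $x\mapsto(\mathrm{gh}_{m/e}(x))_e$ on $\mathbb{W}_m(R)$. Proposition (Cyclotomic Frobenii). Let $d,m\ge 1$ be integers. There exists one and only one family of ring maps $$\mathrm{Frob}_d^{\mathrm{cyc}}: q\text{-}\mathbb{W}_m(R)\longrightarrow q\text{-}\mathbb{W}_{dm}^{(d)}(R),$$ one for every commutative ring $R$, which is natural in $R$ and which is given in $q$-ghost coordinates by $(c_e(q))_{e\mid m}\mapsto(c_{e/d}(q^d))_{d\mid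 e\mid dm}$, i.e. the composition of $\mathrm{Frob}_d^{\mathrm{cyc}}$ with the $q$-ghost map of $q\text{-}\mathbb{W}_{dm}^{(d)}(R)$ is the composition of the $q$-ghost map of $q\text{-}\mathbb{W}_m(R)$ with the ring map $\prod_{e\mid m}R[q]/\Phi_e(q)\to\prod_{d\mid e\mid dm}R[q]/\Phi_e(q)$, $(c_e(q))_{e}\mapsto(c_{e/d}(q^d))_{e}$. -/

import Mathlib

open Polynomial

universe u v

noncomputable section

/-! ### Ghost components and their integral inversion -/

/-- The `n`-th ghost component `∑_{k ∣ n} k * y_k ^ (n / k)` of a family `y`. -/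
def ghostSum {R : Type u} [CommRing R] (y : ℕ → R) (n : ℕ) : R :=
  ∑ k ∈ n.divisors, (k : R) * y k ^ (n / k)

theorem map_ghostSum {R : Type u} {S : Type v} [CommRing R] [CommRing S] (f : R →+* S)
    (y : ℕ → R) (n : ℕ) : f (ghostSum y n) = ghostSum (fun k => f (y k)) n := by
  simp [ghostSum]

theorem ghostSum_congr {R : Type u} [CommRing R] {y z : ℕ → R} {n : ℕ}
    (h : ∀ k ∈ n.divisors, y k = z k) : ghostSum y n = ghostSum z n :=
  Finset.sum_congr rfl fun k hk => by rw [h k hk]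

theorem ghostSum_eq_add {R : Type u} [CommRing R] (y : ℕ → R) {n : ℕ} (hn : n ≠ 0) :
    ghostSum y n = ∑ k ∈ n.properDivisors, (k : R) * y k ^ (n / k) + (n : R) * y n := by
  rw [ghostSum, ← Nat.insert_self_properDivisors hn,
    Finset.sum_insert Nat.self_notMem_properDivisors, Nat.div_self (Nat.pos_of_ne_zero hn), pow_one,
    add_comm]

/-- The Frobenius congruences satisfied by the ghost components of a family of integral
polynomials, with respect to the Frobenius lifts that send every variable to its `p`-th power. -/
def IsDwork {σ : Type u} (G : ℕ → MvPolynomial σ ℤ) : Prop :=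
  ∀ p n : ℕ, p.Prime → n ≠ 0 → p ∣ n →
    ((p : MvPolynomial σ ℤ) ^ n.factorization p) ∣ G n - MvPolynomial.expand p (G (n / p))

theorem prime_dvd_expand_sub_pow {σ : Type u} {p : ℕ} (hp : p.Prime) (a : MvPolynomial σ ℤ) :
    (p : MvPolynomial σ ℤ) ∣ a ^ p - MvPolynomial.expand p a := by
  have := Fact.mk hp
  have : (p : MvPolynomial σ ℤ) = MvPolynomial.C (p : ℤ) := by simp
  rw [this, MvPolynomial.C_dvd_iff_zmod]
  rw [map_sub, map_pow, MvPolynomial.map_expand, MvPolynomial.expand_zmod, sub_self]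

theorem isDwork_ghostSum {σ : Type u} (y : ℕ → MvPolynomial σ ℤ) : IsDwork (ghostSum y) := by
  intro p n hp hn hpn
  obtain ⟨l, rfl⟩ := hpn
  have hl : l ≠ 0 := by rintro rfl; simp at hn
  rw [Nat.mul_div_cancel_left _ hp.pos, ghostSum, ghostSum, map_sum]
  have hsub : l.divisors ⊆ (p * l).divisors := Nat.divisors_subset_of_dvd hn (dvd_mul_left _ _)
  rw [← Finset.sum_sdiff hsub, add_sub_assoc, ← Finset.sum_sub_distrib]
  refine dvd_add (Finset.dvd_sum fun k hk => ?_) (Finset.dvd_sum fun k hk => ?_)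
  · rw [Finset.mem_sdiff, Nat.mem_divisors, Nat.mem_divisors] at hk
    obtain ⟨⟨hk1, -⟩, hk2⟩ := hk
    refine Dvd.dvd.mul_right ?_ _
    have hk0 : k ≠ 0 := by rintro rfl; exact hn (zero_dvd_iff.1 hk1)
    have : p ^ (p * l).factorization p ∣ k := by
      by_contra hcon
      apply hk2
      refine ⟨?_, hl⟩
      rw [hp.pow_dvd_iff_le_factorization hk0] at hcon
      rw [← Nat.factorization_le_iff_dvd hk0 hl]
      intro r
      have h1 := (Nat.factorization_le_iff_dvd hk0 hn).2 hk1 r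
      rw [Nat.factorization_mul hp.ne_zero hl, Finsupp.add_apply] at h1 hcon
      rw [hp.factorization] at h1 hcon
      by_cases hr : r = p
      · subst hr
        simp at h1 hcon
        omega
      · rw [Finsupp.single_eq_of_ne hr] at h1
        omega
    exact_mod_cast Nat.cast_dvd_cast (α := MvPolynomial σ ℤ) this
  · obtain ⟨j, rfl⟩ := Nat.dvd_of_mem_divisors hk
    have hk0 : k ≠ 0 := by rintro rfl; simp at hl
    have hj0 : j ≠ 0 := by rintro rfl; simp at hl
    have e1 : p * (k * j) / k = p * j := by
      rw [show p * (k * j) = k * (p * j) by ring, Nat.mul_div_cancel_left _ (by omega)]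
    have e2 : k * j / k = j := Nat.mul_div_cancel_left _ (by omega)
    rw [e1, e2, map_mul, map_natCast, ← mul_sub, map_pow]
    have e3 : (p * (k * j)).factorization p = k.factorization p + (j.factorization p + 1) := by
      rw [Nat.factorization_mul hp.ne_zero (by positivity), Nat.factorization_mul hk0 hj0]
      simp [hp.factorization]
      ring
    rw [e3, pow_add]
    refine mul_dvd_mul ?_ ?_
    · exact_mod_cast Nat.cast_dvd_cast (α := MvPolynomial σ ℤ) (Nat.ordProj_dvd k p)
    · have h := dvd_sub_pow_of_dvd_sub (prime_dvd_expand_sub_pow hp (y k)) (j.factorization p)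
      obtain ⟨t, ht⟩ := Nat.ordProj_dvd j p
      have e4 : y k ^ (p * j) = ((y k ^ p) ^ p ^ j.factorization p) ^ t := by
        rw [← pow_mul, ← pow_mul]
        congr 1
        conv_lhs => rw [ht]
      have e5 : MvPolynomial.expand p (y k) ^ j
          = (MvPolynomial.expand p (y k) ^ p ^ j.factorization p) ^ t := by
        rw [← pow_mul, ← ht]
      rw [e4, e5]
      exact h.trans (sub_dvd_pow_sub_pow _ _ _)

theorem IsDwork.add {σ : Type u} {G H : ℕ → MvPolynomial σ ℤ} (hG : IsDwork G) (hH : IsDwork H) :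
    IsDwork fun n => G n + H n := by
  intro p n hp hn hpn
  rw [map_add, add_sub_add_comm]
  exact dvd_add (hG p n hp hn hpn) (hH p n hp hn hpn)

theorem IsDwork.mul {σ : Type u} {G H : ℕ → MvPolynomial σ ℤ} (hG : IsDwork G) (hH : IsDwork H) :
    IsDwork fun n => G n * H n := by
  intro p n hp hn hpn
  rw [map_mul, show ∀ a b c e : MvPolynomial σ ℤ, a * b - c * e = (a - c) * b + c * (b - e) from
    fun a b c e => by ring]
  exact dvd_add ((hG p n hp hn hpn).mul_right _) ((hH p n hp hn hpn).mul_left _)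

theorem IsDwork.neg {σ : Type u} {G : ℕ → MvPolynomial σ ℤ} (hG : IsDwork G) :
    IsDwork fun n => -G n := by
  intro p n hp hn hpn
  rw [map_neg, neg_sub_neg, ← neg_sub]
  exact (hG p n hp hn hpn).neg_right

theorem IsDwork.shift {σ : Type u} {G : ℕ → MvPolynomial σ ℤ} (hG : IsDwork G) {c : ℕ}
    (hc : c ≠ 0) : IsDwork fun n => G (c * n) := by
  intro p n hp hn hpn
  have h := hG p (c * n) hp (mul_ne_zero hc hn) (hpn.mul_left c)
  rw [Nat.mul_div_assoc _ hpn] at h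
  refine (pow_dvd_pow _ ?_).trans h
  rw [Nat.factorization_mul hc hn]
  simp

theorem natCast_dvd_of_forall_prime {A : Type u} [CommRing A] {n : ℕ} (hn : n ≠ 0) (a : A)
    (h : ∀ p : ℕ, p.Prime → p ∣ n → ((p : A) ^ n.factorization p) ∣ a) : (n : A) ∣ a := by
  have key : ((∏ p ∈ n.primeFactors, p ^ n.factorization p : ℕ) : A) ∣ a := by
    rw [Nat.cast_prod]
    refine Finset.prod_dvd_of_coprime (fun p hp q hq hpq => ?_) fun p hp => ?_
    · have : Nat.Coprime (p ^ n.factorization p) (q ^ n.factorization q) :=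
        Nat.Coprime.pow _ _ ((Nat.coprime_primes (Nat.prime_of_mem_primeFactors hp)
          (Nat.prime_of_mem_primeFactors hq)).2 hpq)
      have h2 := (Nat.isCoprime_iff_coprime.2 this).map (Int.castRingHom A)
      simpa using h2
    · push_cast
      exact h p (Nat.prime_of_mem_primeFactors hp) (Nat.dvd_of_mem_primeFactors hp)
  rwa [show (∏ p ∈ n.primeFactors, p ^ n.factorization p) = n from
    Nat.prod_factorization_pow_eq_self hn] at key

/-- Recursive inversion of the ghost components, whenever the division by `n` is possible. -/
def ghostInv {σ : Type u} (G : ℕ → MvPolynomial σ ℤ) (n : ℕ) : MvPolynomial σ ℤ :=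
  open Classical in
  if h : ∃ r : MvPolynomial σ ℤ, G n - ∑ k : n.properDivisors,
      ((k : ℕ) : MvPolynomial σ ℤ) * ghostInv G k ^ (n / k) = (n : MvPolynomial σ ℤ) * r
  then h.choose else 0
termination_by n
decreasing_by exact (Nat.mem_properDivisors.1 k.2).2

/-- A family of integral polynomials that satisfies the Frobenius congruences is the family of
ghost components of a family of integral polynomials. -/
theorem IsDwork.ghostSum_ghostInv {σ : Type u} {G : ℕ → MvPolynomial σ ℤ} (hG : IsDwork G)
    (n : ℕ) (hn : n ≠ 0) : ghostSum (ghostInv G) n = G n := by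
  induction n using Nat.strong_induction_on with
  | _ n ih =>
    set P := ghostInv G with hP
    have hd : (n : MvPolynomial σ ℤ) ∣
        G n - ∑ k ∈ n.properDivisors, (k : MvPolynomial σ ℤ) * P k ^ (n / k) := by
      refine natCast_dvd_of_forall_prime hn _ fun p hp hpn => ?_
      have hlt : n / p < n := Nat.div_lt_self (Nat.pos_of_ne_zero hn) hp.one_lt
      have hne : n / p ≠ 0 := (Nat.div_pos (Nat.le_of_dvd (Nat.pos_of_ne_zero hn) hpn) hp.pos).ne'
      have h1 := isDwork_ghostSum (Function.update P n 0) p n hp hn hpn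
      have e1 : ghostSum (Function.update P n 0) (n / p) = G (n / p) := by
        rw [← ih _ hlt hne]
        refine ghostSum_congr fun k hk => ?_
        have := Nat.divisor_le hk
        rw [Function.update_of_ne (by omega)]
      have e2 : ghostSum (Function.update P n 0) n
          = ∑ k ∈ n.properDivisors, (k : MvPolynomial σ ℤ) * P k ^ (n / k) := by
        rw [ghostSum_eq_add _ hn, Function.update_self, mul_zero, add_zero]
        refine Finset.sum_congr rfl fun k hk => ?_
        have := (Nat.mem_properDivisors.1 hk).2
        rw [Function.update_of_ne (by omega)]
      rw [e1, e2] at h1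
      have h3 := dvd_sub (hG p n hp hn hpn) h1
      rwa [sub_sub_sub_cancel_right] at h3
    have hd' : ∃ r : MvPolynomial σ ℤ, G n - ∑ k : n.properDivisors,
        ((k : ℕ) : MvPolynomial σ ℤ) * P k ^ (n / k) = (n : MvPolynomial σ ℤ) * r := by
      rw [Finset.sum_coe_sort n.properDivisors
        (fun k => (k : MvPolynomial σ ℤ) * P k ^ (n / k))]
      exact hd
    have hPn : (n : MvPolynomial σ ℤ) * P n
        = G n - ∑ k ∈ n.properDivisors, (k : MvPolynomial σ ℤ) * P k ^ (n / k) := by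
      rw [hP, ghostInv, dif_pos hd', ← hd'.choose_spec, ← hP]
      rw [Finset.sum_coe_sort n.properDivisors
        (fun k => (k : MvPolynomial σ ℤ) * P k ^ (n / k))]
    rw [ghostSum_eq_add _ hn, hPn]
    ring

theorem ghostSum_injective {A : Type u} [CommRing A] [IsDomain A] [CharZero A] {m : ℕ}
    {y z : ℕ → A} (h : ∀ n, n ∣ m → ghostSum y n = ghostSum z n) (hm : m ≠ 0) (n : ℕ)
    (hn : n ∣ m) : y n = z n := by
  induction n using Nat.strong_induction_on with
  | _ n ih =>
    have hn0 : n ≠ 0 := ne_zero_of_dvd_ne_zero hm hn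
    have h1 := h n hn
    have h2 : ∑ k ∈ n.properDivisors, (k : A) * y k ^ (n / k)
        = ∑ k ∈ n.properDivisors, (k : A) * z k ^ (n / k) :=
      Finset.sum_congr rfl fun k hk => by
        have hk' := Nat.mem_properDivisors.1 hk
        rw [ih k hk'.2 (hk'.1.trans hn)]
    rw [ghostSum_eq_add _ hn0, ghostSum_eq_add _ hn0, h2] at h1
    exact mul_left_cancel₀ (Nat.cast_ne_zero.2 hn0) (add_left_cancel h1)

/-! ### Truncated big Witt vectors -/

/-- The `m`-truncated big Witt vectors of `R`, given by their Witt coordinates `x_e`, `e ∣ m`. -/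
@[ext]
structure BigWitt (m : ℕ) (R : Type u) : Type u where
  /-- The Witt coordinates. -/
  coeff : m.divisors → R

namespace BigWitt

variable {m : ℕ} {R : Type u} {S : Type v} [CommRing R] [CommRing S]

/-- The `n`-th Witt coordinate, extended by zero to all `n`. -/
def get (x : BigWitt m R) (n : ℕ) : R :=
  if h : n ∈ m.divisors then x.coeff ⟨n, h⟩ else 0

/-- The `n`-th ghost coordinate `∑_{k ∣ n} k * x_k ^ (n / k)`; it is meant for `n ∣ m`. -/
def ghost (x : BigWitt m R) (n : ℕ) : R := ghostSum x.get n

/-- The Witt vector whose Witt coordinates are the values of integral polynomials. -/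
def evalPoly {σ : Type*} (m : ℕ) (P : ℕ → MvPolynomial σ ℤ) (a : σ → R) : BigWitt m R :=
  ⟨fun e => MvPolynomial.aeval a (P e)⟩

/-- The universal polynomials of the sum: the integral polynomials whose ghost components are the
sums of the ghost components of two families of variables. -/
def addPoly : ℕ → MvPolynomial (ℕ ⊕ ℕ) ℤ :=
  ghostInv fun n => ghostSum (fun k => MvPolynomial.X (Sum.inl k)) n
    + ghostSum (fun k => MvPolynomial.X (Sum.inr k)) n

/-- The universal polynomials of the product. -/
def mulPoly : ℕ → MvPolynomial (ℕ ⊕ ℕ) ℤ :=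
  ghostInv fun n => ghostSum (fun k => MvPolynomial.X (Sum.inl k)) n
    * ghostSum (fun k => MvPolynomial.X (Sum.inr k)) n

/-- The universal polynomials of the additive inverse. -/
def negPoly : ℕ → MvPolynomial ℕ ℤ :=
  ghostInv fun n => -ghostSum (fun k => MvPolynomial.X k) n

/-- The universal polynomials of the `c`-th Frobenius: their `n`-th ghost component is the
`c * n`-th ghost component of the variables. -/
def frobPoly (c : ℕ) : ℕ → MvPolynomial ℕ ℤ :=
  ghostInv fun n => ghostSum (fun k => MvPolynomial.X k) (c * n)

instance : Zero (BigWitt m R) := ⟨⟨fun _ => 0⟩⟩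

instance : One (BigWitt m R) := ⟨⟨fun e => if (e : ℕ) = 1 then 1 else 0⟩⟩

instance : Add (BigWitt m R) := ⟨fun x y => evalPoly m addPoly (Sum.elim x.get y.get)⟩

instance : Mul (BigWitt m R) := ⟨fun x y => evalPoly m mulPoly (Sum.elim x.get y.get)⟩

instance : Neg (BigWitt m R) := ⟨fun x => evalPoly m negPoly x.get⟩

/-- The coordinatewise map `W_m(R) → W_m(S)` of a ring map, as a function. -/
def mapFun (f : R →+* S) (x : BigWitt m R) : BigWitt m S := ⟨fun e => f (x.coeff e)⟩

theorem get_of_dvd [NeZero m] (x : BigWitt m R) {n : ℕ} (hn : n ∣ m) :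
    x.get n = x.coeff ⟨n, Nat.mem_divisors.2 ⟨hn, NeZero.ne m⟩⟩ :=
  dif_pos _

theorem get_mapFun (f : R →+* S) (x : BigWitt m R) (n : ℕ) :
    (mapFun f x).get n = f (x.get n) := by
  unfold get mapFun
  split_ifs <;> simp

theorem ghost_mapFun (f : R →+* S) (x : BigWitt m R) (n : ℕ) :
    (mapFun f x).ghost n = f (x.ghost n) := by
  rw [ghost, ghost, map_ghostSum]
  exact ghostSum_congr fun k _ => get_mapFun f x k

theorem mapFun_evalPoly {σ : Type*} (f : R →+* S) (P : ℕ → MvPolynomial σ ℤ) (a : σ → R) :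
    mapFun f (evalPoly m P a) = evalPoly m P (fun i => f (a i)) := by
  ext e
  simp only [mapFun, evalPoly, MvPolynomial.aeval_def, MvPolynomial.hom_eval₂]
  congr 1
  exact RingHom.ext_int _ _

theorem ghost_evalPoly [NeZero m] {σ : Type*} (P : ℕ → MvPolynomial σ ℤ) (a : σ → R) {n : ℕ}
    (hn : n ∣ m) : (evalPoly m P a).ghost n = MvPolynomial.aeval a (ghostSum P n) := by
  have := map_ghostSum (MvPolynomial.aeval a : MvPolynomial σ ℤ →ₐ[ℤ] R).toRingHom P n
  simp only [AlgHom.toRingHom_eq_coe, RingHom.coe_coe] at this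
  rw [this, ghost]
  refine ghostSum_congr fun k hk => ?_
  rw [get_of_dvd _ ((Nat.dvd_of_mem_divisors hk).trans hn)]
  rfl

theorem aeval_ghostSum_X {σ : Type*} (g : ℕ → σ) (a : σ → R) (n : ℕ) :
    MvPolynomial.aeval a (ghostSum (fun k => (MvPolynomial.X (g k) : MvPolynomial σ ℤ)) n)
      = ghostSum (fun k => a (g k)) n := by
  have := map_ghostSum (MvPolynomial.aeval a : MvPolynomial σ ℤ →ₐ[ℤ] R).toRingHom
    (fun k => MvPolynomial.X (g k)) n
  simpa using this

theorem ghost_zero [NeZero m] {n : ℕ} (hn : n ∣ m) : (0 : BigWitt m R).ghost n = 0 := by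
  have hn0 : n ≠ 0 := ne_zero_of_dvd_ne_zero (NeZero.ne m) hn
  rw [ghost, ghostSum]
  refine Finset.sum_eq_zero fun k hk => ?_
  have hk' := Nat.dvd_of_mem_divisors hk
  rw [get_of_dvd _ (hk'.trans hn)]
  have : n / k ≠ 0 := by
    have := Nat.div_pos (Nat.divisor_le hk) (Nat.pos_of_mem_divisors hk)
    omega
  exact mul_eq_zero_of_right _ (zero_pow this)

theorem ghost_one [NeZero m] {n : ℕ} (hn : n ∣ m) : (1 : BigWitt m R).ghost n = 1 := by
  have hn0 : n ≠ 0 := ne_zero_of_dvd_ne_zero (NeZero.ne m) hn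
  have key : ∀ k ∈ n.divisors, (1 : BigWitt m R).get k = if k = 1 then 1 else 0 := fun k hk => by
    rw [get_of_dvd _ ((Nat.dvd_of_mem_divisors hk).trans hn)]
    rfl
  rw [ghost, ghostSum_congr key, ghostSum, Finset.sum_eq_single 1]
  · simp
  · intro k hk hk1
    have : n / k ≠ 0 := by
      have := Nat.div_pos (Nat.divisor_le hk) (Nat.pos_of_mem_divisors hk)
      omega
    simp [hk1, this]
  · intro h
    exact absurd (Nat.mem_divisors.2 ⟨one_dvd _, hn0⟩) h

theorem ghost_add [NeZero m] (x y : BigWitt m R) {n : ℕ} (hn : n ∣ m) :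
    (x + y).ghost n = x.ghost n + y.ghost n := by
  have hn0 : n ≠ 0 := ne_zero_of_dvd_ne_zero (NeZero.ne m) hn
  change (evalPoly m addPoly (Sum.elim x.get y.get)).ghost n = _
  rw [ghost_evalPoly _ _ hn, addPoly,
    ((isDwork_ghostSum _).add (isDwork_ghostSum _)).ghostSum_ghostInv n hn0, map_add,
    aeval_ghostSum_X, aeval_ghostSum_X]
  rfl

theorem ghost_mul [NeZero m] (x y : BigWitt m R) {n : ℕ} (hn : n ∣ m) :
    (x * y).ghost n = x.ghost n * y.ghost n := by
  have hn0 : n ≠ 0 := ne_zero_of_dvd_ne_zero (NeZero.ne m) hn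
  change (evalPoly m mulPoly (Sum.elim x.get y.get)).ghost n = _
  rw [ghost_evalPoly _ _ hn, mulPoly,
    ((isDwork_ghostSum _).mul (isDwork_ghostSum _)).ghostSum_ghostInv n hn0, map_mul,
    aeval_ghostSum_X, aeval_ghostSum_X]
  rfl

theorem ghost_neg [NeZero m] (x : BigWitt m R) {n : ℕ} (hn : n ∣ m) :
    (-x).ghost n = -x.ghost n := by
  have hn0 : n ≠ 0 := ne_zero_of_dvd_ne_zero (NeZero.ne m) hn
  change (evalPoly m negPoly x.get).ghost n = _
  rw [ghost_evalPoly _ _ hn, negPoly, (isDwork_ghostSum _).neg.ghostSum_ghostInv n hn0, map_neg,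
    aeval_ghostSum_X (fun k => k)]
  rfl

theorem mapFun_zero (f : R →+* S) : mapFun f (0 : BigWitt m R) = 0 := by
  ext e
  exact map_zero f

theorem mapFun_one (f : R →+* S) : mapFun f (1 : BigWitt m R) = 1 := by
  ext e
  change f (if (e : ℕ) = 1 then 1 else 0) = if (e : ℕ) = 1 then 1 else 0
  split_ifs <;> simp

theorem mapFun_add (f : R →+* S) (x y : BigWitt m R) :
    mapFun f (x + y) = mapFun f x + mapFun f y := by
  change mapFun f (evalPoly m addPoly _) = evalPoly m addPoly _
  rw [mapFun_evalPoly]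
  congr 1
  funext i
  cases i <;> simp [get_mapFun]

theorem mapFun_mul (f : R →+* S) (x y : BigWitt m R) :
    mapFun f (x * y) = mapFun f x * mapFun f y := by
  change mapFun f (evalPoly m mulPoly _) = evalPoly m mulPoly _
  rw [mapFun_evalPoly]
  congr 1
  funext i
  cases i <;> simp [get_mapFun]

theorem mapFun_neg (f : R →+* S) (x : BigWitt m R) : mapFun f (-x) = -mapFun f x := by
  change mapFun f (evalPoly m negPoly _) = evalPoly m negPoly _
  rw [mapFun_evalPoly]
  congr 1
  funext i
  simp [get_mapFun]

theorem ext_ghost {A : Type u} [CommRing A] [IsDomain A] [CharZero A] {x y : BigWitt m A}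
    (h : [NeZero m] → ∀ n, n ∣ m → x.ghost n = y.ghost n) : x = y := by
  ext e
  have he := Nat.mem_divisors.1 e.2
  have : NeZero m := ⟨he.2⟩
  have h1 := ghostSum_injective h he.2 e he.1
  rwa [get_of_dvd _ he.1, get_of_dvd _ he.1] at h1

theorem mapFun_surjective {f : R →+* S} (hf : Function.Surjective f) :
    Function.Surjective (mapFun f : BigWitt m R → BigWitt m S) := fun x =>
  ⟨⟨fun e => (hf (x.coeff e)).choose⟩, by ext e; exact (hf (x.coeff e)).choose_spec⟩

/-- The polynomial ring on the elements of `R` surjects onto `R`. -/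
def cover (R : Type u) [CommRing R] : MvPolynomial R ℤ →+* R :=
  (MvPolynomial.aeval (fun r : R => r) : MvPolynomial R ℤ →ₐ[ℤ] R).toRingHom

theorem cover_surjective (R : Type u) [CommRing R] : Function.Surjective (cover R) := fun r =>
  ⟨MvPolynomial.X r, by simp [cover]⟩

theorem mapFun_cover_surjective :
    Function.Surjective (mapFun (cover R) : BigWitt m (MvPolynomial R ℤ) → BigWitt m R) :=
  mapFun_surjective (cover_surjective R)

/-- The ring structure for which all ghost coordinates are ring maps, naturally in `R`. -/
instance instCommRing : CommRing (BigWitt m R) := by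
  refine CommRing.ofMinimalAxioms ?_ ?_ ?_ ?_ ?_ ?_ ?_
  · intro a b c
    obtain ⟨a, rfl⟩ := mapFun_cover_surjective a
    obtain ⟨b, rfl⟩ := mapFun_cover_surjective b
    obtain ⟨c, rfl⟩ := mapFun_cover_surjective c
    simp only [← mapFun_add]
    refine congrArg _ (ext_ghost fun n hn => ?_)
    simp only [ghost_add _ _ hn]
    ring
  · intro a
    obtain ⟨a, rfl⟩ := mapFun_cover_surjective a
    rw [← mapFun_zero (cover R), ← mapFun_add]
    refine congrArg _ (ext_ghost fun n hn => ?_)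
    rw [ghost_add _ _ hn, ghost_zero hn, zero_add]
  · intro a
    obtain ⟨a, rfl⟩ := mapFun_cover_surjective a
    rw [← mapFun_neg, ← mapFun_zero (cover R), ← mapFun_add]
    refine congrArg _ (ext_ghost fun n hn => ?_)
    rw [ghost_add _ _ hn, ghost_zero hn, ghost_neg _ hn, neg_add_cancel]
  · intro a b c
    obtain ⟨a, rfl⟩ := mapFun_cover_surjective a
    obtain ⟨b, rfl⟩ := mapFun_cover_surjective b
    obtain ⟨c, rfl⟩ := mapFun_cover_surjective c
    simp only [← mapFun_mul]
    refine congrArg _ (ext_ghost fun n hn => ?_)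
    simp only [ghost_mul _ _ hn]
    ring
  · intro a b
    obtain ⟨a, rfl⟩ := mapFun_cover_surjective a
    obtain ⟨b, rfl⟩ := mapFun_cover_surjective b
    simp only [← mapFun_mul]
    refine congrArg _ (ext_ghost fun n hn => ?_)
    simp only [ghost_mul _ _ hn]
    ring
  · intro a
    obtain ⟨a, rfl⟩ := mapFun_cover_surjective a
    rw [← mapFun_one (cover R), ← mapFun_mul]
    refine congrArg _ (ext_ghost fun n hn => ?_)
    rw [ghost_mul _ _ hn, ghost_one hn, one_mul]
  · intro a b c
    obtain ⟨a, rfl⟩ := mapFun_cover_surjective a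
    obtain ⟨b, rfl⟩ := mapFun_cover_surjective b
    obtain ⟨c, rfl⟩ := mapFun_cover_surjective c
    simp only [← mapFun_mul, ← mapFun_add]
    refine congrArg _ (ext_ghost fun n hn => ?_)
    simp only [ghost_mul _ _ hn, ghost_add _ _ hn]
    ring

/-- The `n`-th ghost coordinate as a ring map, for `n ∣ m`. -/
def ghostHom (R : Type u) [CommRing R] (m : ℕ) [NeZero m] (n : ℕ) (hn : n ∣ m) :
    BigWitt m R →+* R where
  toFun x := x.ghost n
  map_one' := ghost_one hn
  map_mul' x y := ghost_mul x y hn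
  map_zero' := ghost_zero hn
  map_add' x y := ghost_add x y hn

/-- The ring map `W_m(R) → W_m(S)` induced by a ring map `R → S`. -/
def map (m : ℕ) (f : R →+* S) : BigWitt m R →+* BigWitt m S where
  toFun := mapFun f
  map_one' := mapFun_one f
  map_mul' := mapFun_mul f
  map_zero' := mapFun_zero f
  map_add' := mapFun_add f

/-- The Verschiebung `V_{m/e} : W_e(R) → W_m(R)`, for `e ∣ m`. In Witt coordinates it moves the
`k`-th coordinate to place `(m / e) * k` and puts zero elsewhere. -/
def verschiebung (m : ℕ) {e : ℕ} (x : BigWitt e R) : BigWitt m R :=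
  ⟨fun k => if m / e ∣ (k : ℕ) then x.get (k / (m / e)) else 0⟩

/-- The Frobenius `F_{f/e} : W_f(R) → W_e(R)`, for `e ∣ f`, given in ghost coordinates by
`(x_k)_{k ∣ f} ↦ (x_{(f/e) k})_{k ∣ e}`, naturally in `R`. -/
def frobenius (e : ℕ) {f : ℕ} (x : BigWitt f R) : BigWitt e R :=
  evalPoly e (frobPoly (f / e)) x.get

theorem mapFun_verschiebung (f : R →+* S) {e : ℕ} (x : BigWitt e R) :
    mapFun f (verschiebung m x) = verschiebung m (mapFun f x) := by
  ext k
  simp only [mapFun, verschiebung]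
  split_ifs
  · exact (get_mapFun f x _).symm
  · exact map_zero f

theorem mapFun_frobenius (f : R →+* S) (e : ℕ) (x : BigWitt m R) :
    mapFun f (frobenius e x) = frobenius e (mapFun f x) := by
  rw [frobenius, frobenius, mapFun_evalPoly]
  congr 1
  funext k
  exact (get_mapFun f x k).symm

theorem ghost_frobenius {e f : ℕ} [NeZero e] [NeZero f] (hef : e ∣ f) (x : BigWitt f R) {n : ℕ}
    (hn : n ∣ e) : (frobenius e x).ghost n = x.ghost (f / e * n) := by
  have hn0 : n ≠ 0 := ne_zero_of_dvd_ne_zero (NeZero.ne e) hn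
  have hc : f / e ≠ 0 :=
    (Nat.div_pos (Nat.le_of_dvd (Nat.pos_of_ne_zero (NeZero.ne f)) hef)
      (Nat.pos_of_ne_zero (NeZero.ne e))).ne'
  rw [frobenius, ghost_evalPoly _ _ hn, frobPoly,
    ((isDwork_ghostSum _).shift hc).ghostSum_ghostInv n hn0, aeval_ghostSum_X (fun k => k)]
  rfl

theorem ghost_verschiebung_of_not_dvd [NeZero m] {e : ℕ} (x : BigWitt e R) {n : ℕ} (hn : n ∣ m)
    (h : ¬m / e ∣ n) : (verschiebung m x).ghost n = 0 := by
  rw [ghost, ghostSum]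
  refine Finset.sum_eq_zero fun k hk => ?_
  have hk' := Nat.dvd_of_mem_divisors hk
  have h0 : n / k ≠ 0 := by
    have := Nat.div_pos (Nat.divisor_le hk) (Nat.pos_of_mem_divisors hk)
    omega
  rw [get_of_dvd _ (hk'.trans hn)]
  have : ¬m / e ∣ k := fun h' => h (h'.trans hk')
  simp [verschiebung, this, h0]

theorem ghost_verschiebung [NeZero m] {e : ℕ} (x : BigWitt e R) {n : ℕ}
    (hn : m / e * n ∣ m) :
    (verschiebung m x).ghost (m / e * n) = ((m / e : ℕ) : R) * x.ghost n := by
  set c := m / e with hc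
  have h0 : c * n ≠ 0 := ne_zero_of_dvd_ne_zero (NeZero.ne m) hn
  have hc0 : 0 < c := Nat.pos_of_ne_zero (left_ne_zero_of_mul h0)
  rw [ghost, ghost, ghostSum, ghostSum, Finset.mul_sum]
  have hsub : n.divisors.map ⟨fun k => c * k, mul_right_injective₀ hc0.ne'⟩
      ⊆ (c * n).divisors := by
    intro k hk
    obtain ⟨j, hj, rfl⟩ := Finset.mem_map.1 hk
    exact Nat.mem_divisors.2 ⟨mul_dvd_mul_left _ (Nat.dvd_of_mem_divisors hj), h0⟩
  rw [← Finset.sum_subset hsub, Finset.sum_map]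
  · refine Finset.sum_congr rfl fun j hj => ?_
    have hj' := Nat.dvd_of_mem_divisors hj
    simp only [Function.Embedding.coeFn_mk]
    rw [get_of_dvd _ ((mul_dvd_mul_left c hj').trans hn), Nat.mul_div_mul_left _ _ hc0]
    simp only [verschiebung, ← hc, dvd_mul_right, if_true, Nat.mul_div_cancel_left _ hc0]
    push_cast
    ring
  · intro k hk hk2
    have hk' := Nat.dvd_of_mem_divisors hk
    have hck : ¬c ∣ k := by
      rintro ⟨j, rfl⟩
      refine hk2 (Finset.mem_map.2 ⟨j, Nat.mem_divisors.2
        ⟨Nat.dvd_of_mul_dvd_mul_left hc0 hk', right_ne_zero_of_mul h0⟩, rfl⟩)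
    have hne : c * n / k ≠ 0 := by
      have := Nat.div_pos (Nat.divisor_le hk) (Nat.pos_of_mem_divisors hk)
      omega
    rw [get_of_dvd _ (hk'.trans hn)]
    simp [verschiebung, ← hc, hck, hne]

end BigWitt

/-! ### Cyclotomic quotients -/

/-- The ring `R[q] / Φ_e(q)`. -/
abbrev CycQuot (R : Type u) [CommRing R] (e : ℕ) : Type u :=
  R[X] ⧸ Ideal.span {cyclotomic e R}

theorem cyclotomic_dvd_expand (R : Type u) [CommRing R] {d e : ℕ} (h : d ∣ e) :
    cyclotomic e R ∣ expand R d (cyclotomic (e / d) R) := by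
  rcases Nat.eq_zero_or_pos e with rfl | he
  · simp
  have hd : 0 < d := Nat.pos_of_dvd_of_pos h he
  have key : cyclotomic e ℤ ∣ expand ℤ d (cyclotomic (e / d) ℤ) := by
    have hz := Complex.isPrimitiveRoot_exp e he.ne'
    rw [cyclotomic_eq_minpoly hz he]
    refine minpoly.isIntegrallyClosed_dvd (hz.isIntegral he) ?_
    rw [expand_aeval]
    have hz' : IsPrimitiveRoot (Complex.exp (2 * Real.pi * Complex.I / e) ^ d) (e / d) :=
      hz.pow he (Nat.mul_div_cancel' h).symm
    have := hz'.isRoot_cyclotomic (Nat.div_pos (Nat.le_of_dvd he h) hd)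
    rwa [IsRoot.def, ← map_cyclotomic_int, eval_map] at this
  have := Polynomial.map_dvd (Int.castRingHom R) key
  rwa [map_expand, map_cyclotomic_int, map_cyclotomic_int] at this

/-- The ring map `R[q] / Φ_{e/d}(q) → R[q] / Φ_e(q)`, `c(q) ↦ c(q^d)`, for `d ∣ e`. -/
def cycSubst (R : Type u) [CommRing R] {d e : ℕ} (h : d ∣ e) :
    CycQuot R (e / d) →+* CycQuot R e :=
  Ideal.quotientMap _ (expand R d : R[X] →+* R[X]) (by
    rw [Ideal.span_singleton_le_iff_mem, Ideal.mem_comap, Ideal.mem_span_singleton]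
    exact cyclotomic_dvd_expand R h)

/-- The `q`-integer `[n]_t = 1 + t + ⋯ + t^(n-1)`. -/
def qInt {A : Type u} [CommRing A] (n : ℕ) (t : A) : A := ∑ i ∈ Finset.range n, t ^ i

/-! ### Big `q`-Witt vectors -/

open BigWitt in
/-- The ideal of `W_m(R)[q]` that defines the big `q`-Witt vectors. -/
def qWittIdeal (m : ℕ) (R : Type u) [CommRing R] : Ideal (BigWitt m R)[X] :=
  Ideal.span
    ({a | ∃ e : ℕ, e ∣ m ∧ ∃ x : BigWitt e R, a = (X ^ e - 1) * C (verschiebung m x)} ∪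
     {a | ∃ d e : ℕ, d ∣ e ∧ e ∣ m ∧ ∃ x : BigWitt e R,
        a = qInt (e / d) (X ^ d) * C (verschiebung m x)
          - C (verschiebung m (frobenius d x))})

/-- The `m`-truncated big `q`-Witt vectors `q-W_m(R)`. -/
abbrev QWitt (m : ℕ) (R : Type u) [CommRing R] : Type u := (BigWitt m R)[X] ⧸ qWittIdeal m R

open BigWitt in
/-- The ideal of `W_m(R)[q]` that defines the big `q`-Witt vectors at `d`. -/
def qWittAtIdeal (d m : ℕ) (R : Type u) [CommRing R] : Ideal (BigWitt m R)[X] :=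
  Ideal.span
    ({a | ∃ e : ℕ, e ∣ m ∧ ∃ x : BigWitt e R,
        a = (∏ k ∈ e.divisors with d ∣ k, cyclotomic k (BigWitt m R)) * C (verschiebung m x)} ∪
     {a | ∃ e f : ℕ, d ∣ e ∧ e ∣ f ∧ f ∣ m ∧ ∃ x : BigWitt f R,
        a = qInt (f / e) (X ^ e) * C (verschiebung m x)
          - C (verschiebung m (frobenius e x))})

/-- The `m`-truncated big `q`-Witt vectors at `d`, `q-W_m^{(d)}(R)`. -/
abbrev QWittAt (d m : ℕ) (R : Type u) [CommRing R] : Type u :=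
  (BigWitt m R)[X] ⧸ qWittAtIdeal d m R

theorem map_qInt {A : Type u} {B : Type v} [CommRing A] [CommRing B] (f : A →+* B) (n : ℕ)
    (t : A) : f (qInt n t) = qInt n (f t) := by
  simp [qInt]

theorem qWittIdeal_le_comap {R : Type u} {S : Type v} [CommRing R] [CommRing S] (m : ℕ)
    (f : R →+* S) :
    qWittIdeal m R ≤ (qWittIdeal m S).comap (mapRingHom (BigWitt.map m f)) := by
  rw [qWittIdeal, Ideal.span_le]
  rintro a (⟨e, he, x, rfl⟩ | ⟨d, e, hde, he, x, rfl⟩)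
  · refine Ideal.subset_span (Or.inl ⟨e, he, BigWitt.mapFun f x, ?_⟩)
    rw [← BigWitt.mapFun_verschiebung]
    simp [BigWitt.map]
  · refine Ideal.subset_span (Or.inr ⟨d, e, hde, he, BigWitt.mapFun f x, ?_⟩)
    rw [← BigWitt.mapFun_verschiebung, ← BigWitt.mapFun_frobenius, ← BigWitt.mapFun_verschiebung]
    rw [map_sub, map_mul, map_qInt]
    simp [BigWitt.map]

theorem qWittAtIdeal_le_comap {R : Type u} {S : Type v} [CommRing R] [CommRing S] (d m : ℕ)
    (f : R →+* S) :
    qWittAtIdeal d m R ≤ (qWittAtIdeal d m S).comap (mapRingHom (BigWitt.map m f)) := by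
  rw [qWittAtIdeal, Ideal.span_le]
  rintro a (⟨e, he, x, rfl⟩ | ⟨e, g, hde, heg, hg, x, rfl⟩)
  · refine Ideal.subset_span (Or.inl ⟨e, he, BigWitt.mapFun f x, ?_⟩)
    rw [← BigWitt.mapFun_verschiebung]
    simp [BigWitt.map, Polynomial.map_prod, map_cyclotomic]
  · refine Ideal.subset_span (Or.inr ⟨e, g, hde, heg, hg, BigWitt.mapFun f x, ?_⟩)
    rw [← BigWitt.mapFun_verschiebung, ← BigWitt.mapFun_frobenius, ← BigWitt.mapFun_verschiebung]
    rw [map_sub, map_mul, map_qInt]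
    simp [BigWitt.map]

/-- The ring map `q-W_m(R) → q-W_m(S)` induced by a ring map `R → S`. -/
def QWitt.map {R : Type u} {S : Type v} [CommRing R] [CommRing S] (m : ℕ) (f : R →+* S) :
    QWitt m R →+* QWitt m S :=
  Ideal.quotientMap _ (mapRingHom (BigWitt.map m f)) (qWittIdeal_le_comap m f)

/-- The ring map `q-W_m^{(d)}(R) → q-W_m^{(d)}(S)` induced by a ring map `R → S`. -/
def QWittAt.map {R : Type u} {S : Type v} [CommRing R] [CommRing S] (d m : ℕ) (f : R →+* S) :
    QWittAt d m R →+* QWittAt d m S :=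
  Ideal.quotientMap _ (mapRingHom (BigWitt.map m f)) (qWittAtIdeal_le_comap d m f)

/-! ### `q`-ghost maps -/

/-- The ring map `W_m(R)[q] → R[q] / Φ_e(q)` with `q ↦ q` and `x ↦ gh_{m/e}(x)` for
`x ∈ W_m(R)`, where `e ∣ m`. -/
def preQGhost (R : Type u) [CommRing R] (m : ℕ) [NeZero m] (e : ℕ) (he : e ∣ m) :
    (BigWitt m R)[X] →+* CycQuot R e :=
  (Ideal.Quotient.mk _).comp (mapRingHom (BigWitt.ghostHom R m (m / e) (Nat.div_dvd_of_dvd he)))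

theorem cyclotomic_dvd_qInt (R : Type u) [CommRing R] {k e f : ℕ} (hef : e ∣ f) (hf : f ≠ 0)
    (hkf : k ∣ f) (hke : ¬k ∣ e) : cyclotomic k R ∣ qInt (f / e) (X ^ e : R[X]) := by
  have key : cyclotomic k ℤ ∣ qInt (f / e) (X ^ e : ℤ[X]) := by
    have hk0 : 0 < k := Nat.pos_of_dvd_of_pos hkf (Nat.pos_of_ne_zero hf)
    have h1 : qInt (f / e) (X ^ e : ℤ[X]) * (X ^ e - 1) = X ^ f - 1 := by
      rw [qInt, geom_sum_mul, ← pow_mul, Nat.mul_div_cancel' hef]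
    have h2 : cyclotomic k ℤ ∣ qInt (f / e) (X ^ e : ℤ[X]) * (X ^ e - 1) :=
      h1 ▸ (cyclotomic.dvd_X_pow_sub_one k ℤ).trans (by
        obtain ⟨j, rfl⟩ := hkf
        simpa [pow_mul] using sub_one_dvd_pow_sub_one (X ^ k : ℤ[X]) j)
    refine ((cyclotomic.irreducible hk0).prime.dvd_or_dvd h2).resolve_right fun h3 => hke ?_
    have hz := Complex.isPrimitiveRoot_exp k hk0.ne'
    have hr := hz.isRoot_cyclotomic hk0
    rw [IsRoot.def, ← map_cyclotomic_int, eval_map] at hr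
    obtain ⟨g, hg⟩ := h3
    have h4 := congrArg (eval₂ (Int.castRingHom ℂ)
      (Complex.exp (2 * Real.pi * Complex.I / k))) hg
    rw [eval₂_mul, hr, zero_mul] at h4
    simp only [eval₂_sub, eval₂_pow, eval₂_X, eval₂_one, sub_eq_zero] at h4
    exact hz.dvd_of_pow_eq_one _ h4
  have := Polynomial.map_dvd (Int.castRingHom R) key
  rw [map_cyclotomic_int, ← coe_mapRingHom, map_qInt] at this
  simpa using this

theorem dvd_of_div_dvd_div {m e k : ℕ} (hm : m ≠ 0) (he : e ∣ m) (hk : k ∣ m)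
    (h : m / e ∣ m / k) : k ∣ e := by
  obtain ⟨a, rfl⟩ := he
  have he0 : 0 < e := Nat.pos_of_ne_zero (left_ne_zero_of_mul hm)
  have ha0 : 0 < a := Nat.pos_of_ne_zero (right_ne_zero_of_mul hm)
  rw [Nat.mul_div_cancel_left _ he0] at h
  obtain ⟨c, hc⟩ := h
  refine ⟨c, Nat.eq_of_mul_eq_mul_right ha0 ?_⟩
  rw [mul_assoc, mul_comm c a, ← hc, Nat.mul_div_cancel' hk]

theorem div_mul_div_self {m e k : ℕ} (he : e ∣ m) (hk : k ∣ e) : m / e * (e / k) = m / k := by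
  obtain ⟨b, rfl⟩ := hk
  obtain ⟨a, rfl⟩ := he
  rcases Nat.eq_zero_or_pos k with rfl | hk0
  · simp
  rcases Nat.eq_zero_or_pos b with rfl | hb0
  · simp
  rw [Nat.mul_div_cancel_left _ (by positivity), Nat.mul_div_cancel_left _ hk0, mul_assoc,
    Nat.mul_div_cancel_left _ hk0, mul_comm]

theorem preQGhost_C (R : Type u) [CommRing R] (m : ℕ) [NeZero m] (k : ℕ) (hk : k ∣ m)
    (x : BigWitt m R) : preQGhost R m k hk (C x) = Ideal.Quotient.mk _ (C (x.ghost (m / k))) := by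
  simp [preQGhost, BigWitt.ghostHom]

theorem preQGhost_verschiebung_of_not_dvd (R : Type u) [CommRing R] (m : ℕ) [NeZero m] {k e : ℕ}
    (hk : k ∣ m) (he : e ∣ m) (x : BigWitt e R) (hke : ¬k ∣ e) :
    preQGhost R m k hk (C (BigWitt.verschiebung m x)) = 0 := by
  rw [preQGhost_C, BigWitt.ghost_verschiebung_of_not_dvd _ (Nat.div_dvd_of_dvd hk), C_0, map_zero]
  exact fun h => hke (dvd_of_div_dvd_div (NeZero.ne m) he hk h)

theorem preQGhost_verschiebung (R : Type u) [CommRing R] (m : ℕ) [NeZero m] {k e : ℕ}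
    (hk : k ∣ m) (he : e ∣ m) (x : BigWitt e R) (hke : k ∣ e) :
    preQGhost R m k hk (C (BigWitt.verschiebung m x))
      = ((m / e : ℕ) : CycQuot R k) * Ideal.Quotient.mk _ (C (x.ghost (e / k))) := by
  rw [preQGhost_C, ← div_mul_div_self he hke, BigWitt.ghost_verschiebung]
  · simp
  · rw [div_mul_div_self he hke]
    exact Nat.div_dvd_of_dvd hk

theorem preQGhost_eq_zero (R : Type u) [CommRing R] {d m : ℕ} [NeZero m] {k : ℕ} (hdk : d ∣ k)
    (hk : k ∣ m) (a : (BigWitt m R)[X]) (ha : a ∈ qWittAtIdeal d m R) :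
    preQGhost R m k hk a = 0 := by
  have hm : m ≠ 0 := NeZero.ne m
  rw [← RingHom.mem_ker]
  revert a
  change qWittAtIdeal d m R ≤ RingHom.ker (preQGhost R m k hk)
  rw [qWittAtIdeal, Ideal.span_le]
  rintro a (⟨e, he, x, rfl⟩ | ⟨e, f, hde, hef, hf, x, rfl⟩)
  · rw [SetLike.mem_coe, RingHom.mem_ker, map_mul]
    by_cases hke : k ∣ e
    · refine mul_eq_zero_of_left ?_ _
      rw [preQGhost, RingHom.comp_apply, coe_mapRingHom, Polynomial.map_prod,
        Ideal.Quotient.eq_zero_iff_mem, Ideal.mem_span_singleton]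
      refine dvd_trans (dvd_of_eq ?_) (Finset.dvd_prod_of_mem _ (a := k) ?_)
      · rw [map_cyclotomic]
      · exact Finset.mem_filter.2
          ⟨Nat.mem_divisors.2 ⟨hke, ne_zero_of_dvd_ne_zero hm he⟩, hdk⟩
    · rw [preQGhost_verschiebung_of_not_dvd R m hk he x hke, mul_zero]
  · have hf0 : f ≠ 0 := ne_zero_of_dvd_ne_zero hm hf
    have he0 : e ≠ 0 := ne_zero_of_dvd_ne_zero hf0 hef
    have : NeZero f := ⟨hf0⟩
    have : NeZero e := ⟨he0⟩
    have hX : preQGhost R m k hk X = Ideal.Quotient.mk _ X := by simp [preQGhost]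
    rw [SetLike.mem_coe, RingHom.mem_ker, map_sub, map_mul, map_qInt, map_pow, hX]
    by_cases hkf : k ∣ f
    · by_cases hke : k ∣ e
      · rw [preQGhost_verschiebung R m hk hf x hkf,
          preQGhost_verschiebung R m hk (hef.trans hf) _ hke,
          BigWitt.ghost_frobenius hef x (Nat.div_dvd_of_dvd hke), div_mul_div_self hef hke]
        have hq : (Ideal.Quotient.mk (Ideal.span {cyclotomic k R}) X) ^ e = 1 := by
          rw [← map_pow, ← map_one (Ideal.Quotient.mk (Ideal.span {cyclotomic k R})),
            Ideal.Quotient.eq, Ideal.mem_span_singleton]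
          refine (cyclotomic.dvd_X_pow_sub_one k R).trans ?_
          obtain ⟨j, rfl⟩ := hke
          simpa [pow_mul] using sub_one_dvd_pow_sub_one (X ^ k : R[X]) j
        have hn : (m / f) * (f / e) = m / e := div_mul_div_self hf hef
        rw [hq, ← hn]
        simp only [qInt, one_pow, Finset.sum_const, Finset.card_range, nsmul_eq_mul, mul_one]
        push_cast
        ring
      · have hq : qInt (f / e) ((Ideal.Quotient.mk (Ideal.span {cyclotomic k R}) X) ^ e) = 0 := by
          rw [← map_pow, ← map_qInt, Ideal.Quotient.eq_zero_iff_mem, Ideal.mem_span_singleton]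
          exact cyclotomic_dvd_qInt R hef hf0 hkf hke
        rw [hq, preQGhost_verschiebung_of_not_dvd R m hk (hef.trans hf) _ hke, zero_mul, sub_zero]
    · rw [preQGhost_verschiebung_of_not_dvd R m hk hf x hkf,
        preQGhost_verschiebung_of_not_dvd R m hk (hef.trans hf) _ fun h => hkf (h.trans hef),
        mul_zero, sub_zero]

theorem qWittIdeal_le (R : Type u) [CommRing R] (m : ℕ) [NeZero m] :
    qWittIdeal m R ≤ qWittAtIdeal 1 m R := by
  rw [qWittIdeal, Ideal.span_le]
  rintro a (⟨e, he, x, rfl⟩ | ⟨d, e, hde, he, x, rfl⟩)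
  · refine Ideal.subset_span (Or.inl ⟨e, he, x, ?_⟩)
    have he0 : 0 < e := Nat.pos_of_ne_zero (ne_zero_of_dvd_ne_zero (NeZero.ne m) he)
    simp [prod_cyclotomic_eq_X_pow_sub_one he0]
  · exact Ideal.subset_span (Or.inr ⟨d, e, one_dvd _, hde, he, x, rfl⟩)

/-- The `q`-ghost map `q-W_m(R) → ∏_{e ∣ m} R[q] / Φ_e(q)`: the map of `ℤ[q]`-algebras given by
`x ↦ (gh_{m/e}(x))_e` on `W_m(R)`. -/
def qGhost (R : Type u) [CommRing R] (m : ℕ) [NeZero m] :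
    QWitt m R →+* ((e : {e : ℕ // e ∣ m}) → CycQuot R e) :=
  RingHom.pi fun e => Ideal.Quotient.lift _ (preQGhost R m e e.2) fun a ha =>
    preQGhost_eq_zero R (one_dvd _) e.2 a (qWittIdeal_le R m ha)

/-- The `q`-ghost map `q-W_m^{(d)}(R) → ∏_{d ∣ e ∣ m} R[q] / Φ_e(q)`: the map of `ℤ[q]`-algebras
given by `x ↦ (gh_{m/e}(x))_e` on `W_m(R)`. -/
def qGhostAt (R : Type u) [CommRing R] (d m : ℕ) [NeZero m] :
    QWittAt d m R →+* ((e : {e : ℕ // d ∣ e ∧ e ∣ m}) → CycQuot R e) :=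
  RingHom.pi fun e => Ideal.Quotient.lift _ (preQGhost R m e e.2.2) fun a ha =>
    preQGhost_eq_zero R e.2.1 e.2.2 a ha

/-- The ring map `(c_e(q))_{e ∣ m} ↦ (c_{e/d}(q^d))_{d ∣ e ∣ dm}`. -/
def ghostFrob (R : Type u) [CommRing R] (d m : ℕ) [NeZero d] :
    ((e : {e : ℕ // e ∣ m}) → CycQuot R e) →+*
      ((e : {e : ℕ // d ∣ e ∧ e ∣ d * m}) → CycQuot R e) :=
  RingHom.pi fun e => (cycSubst R e.2.1).comp
    (Pi.evalRingHom (fun e : {e : ℕ // e ∣ m} => CycQuot R e)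
      ⟨(e : ℕ) / d, (Nat.div_dvd_iff_dvd_mul e.2.1 (NeZero.pos d)).2 e.2.2⟩)

end

/-!
*Existence.* If `d ∤ e`, the product of the `Φ_k` with `d ∣ k ∣ e` is empty, so `q-W_{dm}^{(d)}(R)`
kills the image of `V_{dm/e}`. Those images generate the kernel of the truncation
`W_{dm}(R) → W_m(R)`, so the ring map `W_{dm}(R) → q-W_{dm}^{(d)}(R)` factors through `W_m(R)`.
Extend it by `q ↦ q^d`: the relations with `[f/e]_{q^e}` in `q-W_m(R)` go to those with
`[df/de]_{q^{de}}`, and `q^e - 1` goes to `q^{de} - 1`, a multiple of the product of the `Φ_k` with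
`d ∣ k ∣ de`.

*Uniqueness.* By naturality it suffices to treat polynomial rings `ℤ[T]`, where the `q`-ghost map
of `q-W_{dm}^{(d)}` is injective: over `ℤ[q]` the source is generated by one element for each
monomial `T^s`, namely `V_{m/g}[T^{s/g}]` with `g` the largest divisor of `m` for which `T^s` is a
`g`-th power. It is annihilated by the product of the `Φ_k` with `d ∣ k ∣ dg`, and comparing
coefficients of `T^{s/e}` in the `q`-ghost coordinate at `de` shows that each `Φ_{de}` with
`e ∣ g` divides the coefficient of this generator in any linear combination in the kernel.
-/

theorem div_pos_of_dvd {m e : ℕ} [NeZero m] (he : e ∣ m) : 0 < m / e :=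
  Nat.div_pos (Nat.le_of_dvd (NeZero.pos m) he) (Nat.pos_of_dvd_of_pos he (NeZero.pos m))

theorem div_mul_dvd_iff {m e j : ℕ} [NeZero m] (he : e ∣ m) : m / e * j ∣ m ↔ j ∣ e := by
  rw [← Nat.mul_dvd_mul_iff_left (div_pos_of_dvd he) (b := j), Nat.div_mul_cancel he]

namespace BigWitt

section Single

variable {R : Type u} {S : Type v} [CommRing R] [CommRing S] {N : ℕ}

/-- The Witt vector `V_n[a]` (the Verschiebung of a Teichmüller representative), encoded by its
Witt coordinates: `a` at place `n` and zero elsewhere. In particular `single N 1 a` is the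
Teichmüller representative `[a]`. -/
def single (N n : ℕ) (a : R) : BigWitt N R :=
  ⟨fun k => if (k : ℕ) = n then a else 0⟩

theorem get_single [NeZero N] (n : ℕ) (a : R) {k : ℕ} (hk : k ∣ N) :
    (single N n a).get k = if k = n then a else 0 := by
  rw [get_of_dvd _ hk, single]

theorem single_zero (n : ℕ) : single N n (0 : R) = 0 := by
  ext k
  exact ite_self 0

theorem mapFun_single (f : R →+* S) (n : ℕ) (a : R) :
    mapFun f (single N n a) = single N n (f a) := by
  ext k
  simp only [mapFun, single, apply_ite f, map_zero]

theorem verschiebung_single [NeZero N] {e : ℕ} (he : e ∣ N) (a : R) :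
    verschiebung N (single e 1 a) = single N (N / e) a := by
  have : NeZero e := ⟨ne_zero_of_dvd_ne_zero (NeZero.ne N) he⟩
  have hpos : 0 < N / e := div_pos_of_dvd he
  ext ⟨k, hk⟩
  change (if N / e ∣ k then (single e 1 a).get (k / (N / e)) else 0) = if k = N / e then a else 0
  by_cases hdvd : N / e ∣ k
  · obtain ⟨j, rfl⟩ := hdvd
    rw [if_pos (dvd_mul_right _ _), Nat.mul_div_cancel_left _ hpos,
      get_single _ _ ((div_mul_dvd_iff he).1 (Nat.dvd_of_mem_divisors hk))]
    simp only [Nat.mul_eq_left hpos.ne']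
  · rw [if_neg hdvd, if_neg fun h => hdvd h.symm.dvd]

theorem ghost_single [NeZero N] (n : ℕ) (a : R) {k : ℕ} (hk : k ∣ N) :
    (single N n a).ghost k = if n ∣ k then (n : R) * a ^ (k / n) else 0 := by
  have hterm : ∀ j ∈ k.divisors, (j : R) * (single N n a).get j ^ (k / j)
      = if j = n then (n : R) * a ^ (k / n) else 0 := by
    intro j hj
    have hpow : k / j ≠ 0 := (Nat.div_pos (Nat.divisor_le hj) (Nat.pos_of_mem_divisors hj)).ne'
    rw [get_single _ _ ((Nat.dvd_of_mem_divisors hj).trans hk)]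
    split_ifs with hjn
    · rw [hjn]
    · rw [zero_pow hpow, mul_zero]
  rw [ghost, ghostSum, Finset.sum_congr rfl hterm, Finset.sum_ite_eq']
  simp only [Nat.mem_divisors, and_iff_left (ne_zero_of_dvd_ne_zero (NeZero.ne N) hk)]

theorem frobenius_single_one {e f : ℕ} [NeZero f] (hef : e ∣ f) (a : R) :
    frobenius e (single f 1 a) = single e 1 (a ^ (f / e)) := by
  obtain ⟨a, rfl⟩ := cover_surjective R a
  rw [← map_pow, ← mapFun_single, ← mapFun_single, ← mapFun_frobenius]
  refine congrArg _ (ext_ghost fun n hn => ?_)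
  have hnf : f / e * n ∣ f := (div_mul_dvd_iff hef).2 hn
  rw [ghost_frobenius hef _ hn, ghost_single _ _ hnf, ghost_single _ _ hn,
    if_pos (one_dvd _), if_pos (one_dvd _), Nat.div_one, Nat.div_one, pow_mul]

theorem sum_single_get (x : BigWitt N R) : ∑ n ∈ N.divisors, single N n (x.get n) = x := by
  obtain ⟨x, rfl⟩ := mapFun_cover_surjective x
  simp only [get_mapFun, ← mapFun_single]
  refine (map_sum (BigWitt.map N (cover R)) _ _).symm.trans
    (congrArg (mapFun (cover R)) (ext_ghost fun k hk => ?_))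
  calc (∑ n ∈ N.divisors, single N n (x.get n)).ghost k
      = ∑ n ∈ N.divisors, (single N n (x.get n)).ghost k := map_sum (ghostHom _ N k hk) _ _
    _ = ∑ n ∈ N.divisors with n ∣ k, (n : MvPolynomial R ℤ) * x.get n ^ (k / n) := by
      rw [Finset.sum_filter]
      exact Finset.sum_congr rfl fun n _ => ghost_single n _ hk
    _ = x.ghost k := by rw [Nat.divisors_filter_dvd_of_dvd (NeZero.ne N) hk, ghost, ghostSum]

theorem get_eq_zero_of_ghost_eq_zero [IsDomain R] [CharZero R] {x : BigWitt N R} {n : ℕ}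
    (h : ∀ k, k ∣ n → x.ghost k = 0) (hn : n ≠ 0) : x.get n = 0 := by
  refine ghostSum_injective (z := fun _ => 0) (fun k hk => (h k hk).trans ?_) hn n dvd_rfl
  refine (Finset.sum_eq_zero fun j hj => ?_).symm
  rw [zero_pow (Nat.div_pos (Nat.divisor_le hj) (Nat.pos_of_mem_divisors hj)).ne', mul_zero]

theorem ghost_single_sub_sub_eq_zero [NeZero N] {n : ℕ} (a b : R) {k : ℕ} (hk : k ∣ N)
    (hkn : k ≤ n) : (single N n (a - b) - (single N n a - single N n b)).ghost k = 0 := by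
  have hk0 : 0 < k := Nat.pos_of_dvd_of_pos hk (NeZero.pos N)
  have hsub (x y : BigWitt N R) : (x - y).ghost k = x.ghost k - y.ghost k :=
    map_sub (ghostHom R N k hk) x y
  simp only [hsub, ghost_single _ _ hk]
  split_ifs with hnk
  · obtain rfl : k = n := hkn.antisymm (Nat.le_of_dvd hk0 hnk)
    rw [Nat.div_self hk0]
    ring
  · rw [sub_zero, sub_zero]

theorem get_single_sub_sub_eq_zero [NeZero N] {n : ℕ} (a b : R) {k : ℕ} (hk : k ∣ N)
    (hkn : k ≤ n) : (single N n (a - b) - (single N n a - single N n b)).get k = 0 := by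
  obtain ⟨a, rfl⟩ := cover_surjective R a
  obtain ⟨b, rfl⟩ := cover_surjective R b
  have hk0 : 0 < k := Nat.pos_of_dvd_of_pos hk (NeZero.pos N)
  have hlift : (single N n (a - b) - (single N n a - single N n b)).get k = 0 :=
    get_eq_zero_of_ghost_eq_zero (fun j hj => ghost_single_sub_sub_eq_zero a b (hj.trans hk)
      ((Nat.le_of_dvd hk0 hj).trans hkn)) hk0.ne'
  have hmap_sub (x y : BigWitt N (MvPolynomial R ℤ)) :
      mapFun (cover R) x - mapFun (cover R) y = mapFun (cover R) (x - y) :=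
    (map_sub (BigWitt.map N (cover R)) x y).symm
  simp only [← map_sub, ← mapFun_single, hmap_sub, get_mapFun, hlift, map_zero]

-- `V_n[a - b]` and `V_n[a] - V_n[b]` differ by a Witt vector supported in places above `n`.
theorem single_sub_mem [NeZero N] {H : AddSubgroup (BigWitt N R)} {n : ℕ}
    (hH : ∀ k, k ∣ N → n < k → ∀ a, single N k a ∈ H) {a b : R} (ha : single N n a ∈ H)
    (hb : single N n b ∈ H) : single N n (a - b) ∈ H := by
  rw [← sub_add_cancel (single N n (a - b)) (single N n a - single N n b)]
  refine H.add_mem ?_ (H.sub_mem ha hb)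
  rw [← sum_single_get (single N n (a - b) - (single N n a - single N n b))]
  refine H.sum_mem fun k hk => ?_
  have hkN : k ∣ N := Nat.dvd_of_mem_divisors hk
  rcases le_or_gt k n with hkn | hnk
  · rw [get_single_sub_sub_eq_zero a b hkN hkn, single_zero]
    exact H.zero_mem
  · exact hH k hkN hnk _

theorem closure_single [NeZero N] {G : Set R} (hG : AddSubgroup.closure G = ⊤) :
    AddSubgroup.closure {x : BigWitt N R | ∃ n, n ∣ N ∧ ∃ a ∈ G, x = single N n a} = ⊤ := by
  set H := AddSubgroup.closure {x : BigWitt N R | ∃ n, n ∣ N ∧ ∃ a ∈ G, x = single N n a}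
  have hsingle : ∀ n, n ∣ N → ∀ a, single N n a ∈ H := by
    intro n
    induction h : N - n using Nat.strong_induction_on generalizing n with | _ i ih =>
    subst h
    intro hn a
    have habove : ∀ k, k ∣ N → n < k → ∀ a, single N k a ∈ H := fun k hk hnk =>
      ih (N - k) (Nat.sub_lt_sub_left (hnk.trans_le (Nat.le_of_dvd (NeZero.pos N) hk)) hnk)
        k rfl hk
    have hzero : single N n (0 : R) ∈ H := by
      rw [single_zero]
      exact H.zero_mem
    have ha : a ∈ AddSubgroup.closure G := hG ▸ AddSubgroup.mem_top a
    induction ha using AddSubgroup.closure_induction with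
    | mem a ha => exact AddSubgroup.subset_closure ⟨n, hn, a, ha, rfl⟩
    | zero => exact hzero
    | neg a _ ha => exact zero_sub a ▸ single_sub_mem habove hzero ha
    | add a b _ _ ha hb =>
      rw [← sub_neg_eq_add, ← zero_sub b]
      exact single_sub_mem habove ha (single_sub_mem habove hzero hb)
  refine (AddSubgroup.eq_top_iff' H).2 fun x => ?_
  rw [← sum_single_get x]
  exact H.sum_mem fun n hn => hsingle n (Nat.dvd_of_mem_divisors hn) _

end Single

section Truncation

variable {R : Type u} {S : Type v} [CommRing R] [CommRing S]

/-- The truncation `W_N(R) → W_m(R)`, for `m ∣ N`, as a function: it keeps the Witt coordinates at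
the divisors of `m`. -/
def truncFun (m : ℕ) {N : ℕ} (x : BigWitt N R) : BigWitt m R := ⟨fun k => x.get k⟩

theorem get_truncFun {m N : ℕ} [NeZero m] (x : BigWitt N R) {n : ℕ} (hn : n ∣ m) :
    (truncFun m x).get n = x.get n := by
  rw [get_of_dvd _ hn, truncFun]

theorem ghost_truncFun {m N : ℕ} [NeZero m] (x : BigWitt N R) {n : ℕ} (hn : n ∣ m) :
    (truncFun m x).ghost n = x.ghost n :=
  ghostSum_congr fun _ hk => get_truncFun x ((Nat.dvd_of_mem_divisors hk).trans hn)

theorem mapFun_truncFun (f : R →+* S) {m N : ℕ} (x : BigWitt N R) :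
    mapFun f (truncFun m x) = truncFun m (mapFun f x) := by
  ext k
  exact (get_mapFun f x k).symm

theorem truncFun_surjective {m N : ℕ} [NeZero N] (h : m ∣ N) :
    Function.Surjective (truncFun m : BigWitt N R → BigWitt m R) := fun x => by
  have : NeZero m := ⟨ne_zero_of_dvd_ne_zero (NeZero.ne N) h⟩
  refine ⟨truncFun N x, ?_⟩
  ext k
  have hk := Nat.dvd_of_mem_divisors k.2
  change (truncFun N x).get k = x.coeff k
  rw [get_truncFun x (hk.trans h), get_of_dvd x hk]

/-- The truncation `W_N(R) → W_m(R)`, for `m ∣ N`. -/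
def trunc (R : Type u) [CommRing R] {m N : ℕ} [NeZero N] (h : m ∣ N) :
    BigWitt N R →+* BigWitt m R where
  toFun := truncFun m
  map_one' := by
    rw [← mapFun_one (cover R), ← mapFun_truncFun, ← mapFun_one (cover R)]
    refine congrArg _ (ext_ghost fun n hn => ?_)
    rw [ghost_truncFun _ hn, ghost_one hn, ghost_one (hn.trans h)]
  map_zero' := by
    rw [← mapFun_zero (cover R), ← mapFun_truncFun, ← mapFun_zero (cover R)]
    refine congrArg _ (ext_ghost fun n hn => ?_)
    rw [ghost_truncFun _ hn, ghost_zero hn, ghost_zero (hn.trans h)]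
  map_add' x y := by
    obtain ⟨x, rfl⟩ := mapFun_cover_surjective x
    obtain ⟨y, rfl⟩ := mapFun_cover_surjective y
    simp only [← mapFun_add, ← mapFun_truncFun]
    refine congrArg _ (ext_ghost fun n hn => ?_)
    simp only [ghost_truncFun _ hn, ghost_add _ _ hn, ghost_add _ _ (hn.trans h)]
  map_mul' x y := by
    obtain ⟨x, rfl⟩ := mapFun_cover_surjective x
    obtain ⟨y, rfl⟩ := mapFun_cover_surjective y
    simp only [← mapFun_mul, ← mapFun_truncFun]
    refine congrArg _ (ext_ghost fun n hn => ?_)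
    simp only [ghost_truncFun _ hn, ghost_mul _ _ hn, ghost_mul _ _ (hn.trans h)]

theorem truncFun_verschiebung {d m e : ℕ} [NeZero d] [NeZero m] (he : e ∣ m)
    (x : BigWitt (d * e) R) :
    truncFun m (verschiebung (d * m) x) = verschiebung m (truncFun e x) := by
  have : NeZero e := ⟨ne_zero_of_dvd_ne_zero (NeZero.ne m) he⟩
  ext ⟨k, hk⟩
  have hkm := Nat.dvd_of_mem_divisors hk
  change (verschiebung (d * m) x).get k
    = if m / e ∣ k then (truncFun e x).get (k / (m / e)) else 0
  rw [get_of_dvd _ (hkm.mul_left d)]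
  simp only [verschiebung, Nat.mul_div_mul_left _ _ (NeZero.pos d)]
  split_ifs with hdvd
  · obtain ⟨j, rfl⟩ := hdvd
    rw [Nat.mul_div_cancel_left _ (div_pos_of_dvd he),
      get_truncFun x ((div_mul_dvd_iff he).1 hkm)]
  · rfl

theorem truncFun_frobenius {d e f : ℕ} [NeZero d] [NeZero f] (hef : e ∣ f)
    (x : BigWitt (d * f) R) :
    truncFun e (frobenius (d * e) x) = frobenius e (truncFun f x) := by
  obtain ⟨x, rfl⟩ := mapFun_cover_surjective x
  simp only [← mapFun_frobenius, ← mapFun_truncFun]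
  refine congrArg _ (ext_ghost fun n hn => ?_)
  have hnf : f / e * n ∣ f := (div_mul_dvd_iff hef).2 hn
  rw [ghost_truncFun _ hn, ghost_frobenius (mul_dvd_mul_left d hef) _ (hn.mul_left d),
    ghost_frobenius hef _ hn, ghost_truncFun _ hnf, Nat.mul_div_mul_left _ _ (NeZero.pos d)]

end Truncation

end BigWitt

open BigWitt

section PolynomialAction

attribute [local instance] Polynomial.algebra

/-- The ring map `W_N(R) → q-W_N^{(d)}(R)` sending a Witt vector to its class as a constant
polynomial in `q`. -/
noncomputable def QWittAt.ofWitt (d N : ℕ) (R : Type u) [CommRing R] :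
    BigWitt N R →+* QWittAt d N R :=
  (Ideal.Quotient.mk _).comp C

namespace QWittAt

variable {R : Type u} [CommRing R] {d N : ℕ}

theorem smul_ofWitt (p : ℤ[X]) (x : BigWitt N R) :
    p • ofWitt d N R x
      = Ideal.Quotient.mk (qWittAtIdeal d N R) (p.map (Int.castRingHom _) * C x) := by
  exact congrArg (Ideal.Quotient.mk _) (Algebra.smul_def p (C x))

theorem prod_cyclotomic_smul_verschiebung {e : ℕ} (he : e ∣ N) (x : BigWitt e R) :
    (∏ k ∈ e.divisors with d ∣ k, cyclotomic k ℤ) • ofWitt d N R (verschiebung N x) = 0 := by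
  rw [smul_ofWitt, Ideal.Quotient.eq_zero_iff_mem, Polynomial.map_prod]
  simp only [map_cyclotomic]
  exact Ideal.subset_span (Or.inl ⟨e, he, x, rfl⟩)

theorem qInt_smul_verschiebung {e f : ℕ} (hde : d ∣ e) (hef : e ∣ f) (hf : f ∣ N)
    (x : BigWitt f R) :
    qInt (f / e) (X ^ e : ℤ[X]) • ofWitt d N R (verschiebung N x)
      = ofWitt d N R (verschiebung N (frobenius e x)) := by
  rw [smul_ofWitt, ← coe_mapRingHom, map_qInt, coe_mapRingHom, Polynomial.map_pow, map_X]
  exact Ideal.Quotient.eq.2 (Ideal.subset_span (Or.inr ⟨e, f, hde, hef, hf, x, rfl⟩))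

theorem X_pow_sub_one_smul_verschiebung [NeZero N] {e : ℕ} (he : e ∣ N) (x : BigWitt e R) :
    (X ^ e - 1 : ℤ[X]) • ofWitt d N R (verschiebung N x) = 0 := by
  rw [← prod_cyclotomic_eq_X_pow_sub_one (Nat.pos_of_dvd_of_pos he (NeZero.pos N)),
    ← Finset.prod_filter_not_mul_prod_filter _ (d ∣ ·), mul_smul,
    prod_cyclotomic_smul_verschiebung he, smul_zero]

-- The defining product of cyclotomic polynomials is empty if `d ∤ e`.
theorem ofWitt_verschiebung_of_not_dvd {e : ℕ} (he : e ∣ N) (hde : ¬d ∣ e) (x : BigWitt e R) :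
    ofWitt d N R (verschiebung N x) = 0 := by
  have hempty : {k ∈ e.divisors | d ∣ k} = ∅ :=
    Finset.filter_eq_empty_iff.2 fun k hk hdk => hde (hdk.trans (Nat.dvd_of_mem_divisors hk))
  simpa only [hempty, Finset.prod_empty, one_smul] using
    prod_cyclotomic_smul_verschiebung (d := d) he x

theorem ofWitt_eq_zero_of_truncFun_eq_zero {m : ℕ} [NeZero d] [NeZero m] {x : BigWitt (d * m) R}
    (hx : truncFun m x = 0) : ofWitt d (d * m) R x = 0 := by
  rw [← sum_single_get x, map_sum]
  refine Finset.sum_eq_zero fun n hn => ?_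
  have hnN : n ∣ d * m := Nat.dvd_of_mem_divisors hn
  by_cases hnm : n ∣ m
  · have hget : x.get n = 0 := by rw [← get_truncFun x hnm, hx, get_of_dvd _ hnm]; rfl
    rw [hget, single_zero, map_zero]
  · have hdn : ¬d ∣ d * m / n := fun h => hnm <| by
      obtain ⟨c, hc⟩ := h
      have hdm : d * m = d * (c * n) := by rw [← mul_assoc, ← hc, Nat.div_mul_cancel hnN]
      exact ⟨c, by rw [Nat.eq_of_mul_eq_mul_left (NeZero.pos d) hdm, mul_comm]⟩
    rw [← Nat.div_div_self hnN (NeZero.ne _), ← verschiebung_single (Nat.div_dvd_of_dvd hnN),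
      Nat.div_div_self hnN (NeZero.ne _),
      ofWitt_verschiebung_of_not_dvd (Nat.div_dvd_of_dvd hnN) hdn]

end QWittAt

section Existence

namespace QWitt

variable {R : Type u} {A : Type v} [CommRing R] [CommRing A] {m : ℕ}

/-- The universal property of `q-W_m(R)`: a ring map `g` out of `W_m(R)` together with an image `q`
of the variable extends to `q-W_m(R)` as soon as the defining relations hold. -/
noncomputable def lift (g : BigWitt m R →+* A) (q : A)
    (hV : ∀ e, e ∣ m → ∀ x : BigWitt e R, (q ^ e - 1) * g (verschiebung m x) = 0)
    (hF : ∀ e f, e ∣ f → f ∣ m → ∀ x : BigWitt f R,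
      qInt (f / e) (q ^ e) * g (verschiebung m x) = g (verschiebung m (frobenius e x))) :
    QWitt m R →+* A :=
  Ideal.Quotient.lift _ (eval₂RingHom g q) fun a ha => by
    refine RingHom.mem_ker.1 (Ideal.span_le.2 ?_ ha)
    rintro _ (⟨e, he, x, rfl⟩ | ⟨e, f, hef, hf, x, rfl⟩)
    · simpa using hV e he x
    · rw [SetLike.mem_coe, RingHom.mem_ker, map_sub, map_mul, map_qInt, map_pow,
        coe_eval₂RingHom, eval₂_X, eval₂_C, eval₂_C, hF e f hef hf x, sub_self]

end QWitt

variable (R : Type u) [CommRing R] (d m : ℕ) [NeZero d] [NeZero m]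

/-- The ring map `W_m(R) → q-W_{dm}^{(d)}(R)` induced by `W_{dm}(R) → q-W_{dm}^{(d)}(R)`, which
factors through the truncation. -/
noncomputable def wittToQWittAt : BigWitt m R →+* QWittAt d (d * m) R :=
  (trunc R (dvd_mul_left m d)).liftOfSurjective (truncFun_surjective (dvd_mul_left m d))
    ⟨QWittAt.ofWitt d (d * m) R, fun _ hx => QWittAt.ofWitt_eq_zero_of_truncFun_eq_zero hx⟩

variable {R d m}

theorem wittToQWittAt_truncFun (x : BigWitt (d * m) R) :
    wittToQWittAt R d m (truncFun m x) = QWittAt.ofWitt d (d * m) R x :=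
  RingHom.liftOfSurjective_comp_apply _ _ _ x

theorem wittToQWittAt_verschiebung {e : ℕ} (he : e ∣ m) (x : BigWitt (d * e) R) :
    wittToQWittAt R d m (verschiebung m (truncFun e x))
      = QWittAt.ofWitt d (d * m) R (verschiebung (d * m) x) := by
  rw [← truncFun_verschiebung he, wittToQWittAt_truncFun]

theorem X_pow_sub_one_smul_wittToQWittAt {e : ℕ} (he : e ∣ m) (x : BigWitt e R) :
    (X ^ (d * e) - 1 : ℤ[X]) • wittToQWittAt R d m (verschiebung m x) = 0 := by
  have : NeZero e := ⟨ne_zero_of_dvd_ne_zero (NeZero.ne m) he⟩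
  obtain ⟨x, rfl⟩ := truncFun_surjective (dvd_mul_left e d) x
  rw [wittToQWittAt_verschiebung he]
  exact QWittAt.X_pow_sub_one_smul_verschiebung (mul_dvd_mul_left d he) x

theorem qInt_smul_wittToQWittAt {e f : ℕ} (hef : e ∣ f) (hf : f ∣ m) (x : BigWitt f R) :
    qInt (f / e) (X ^ (d * e) : ℤ[X]) • wittToQWittAt R d m (verschiebung m x)
      = wittToQWittAt R d m (verschiebung m (frobenius e x)) := by
  have : NeZero f := ⟨ne_zero_of_dvd_ne_zero (NeZero.ne m) hf⟩
  obtain ⟨x, rfl⟩ := truncFun_surjective (dvd_mul_left f d) x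
  rw [← truncFun_frobenius hef, wittToQWittAt_verschiebung hf,
    wittToQWittAt_verschiebung (hef.trans hf), ← Nat.mul_div_mul_left f e (NeZero.pos d)]
  exact QWittAt.qInt_smul_verschiebung (dvd_mul_right d e) (mul_dvd_mul_left d hef)
    (mul_dvd_mul_left d hf) x

variable (R d m)

/-- The cyclotomic Frobenius `q-W_m(R) → q-W_{dm}^{(d)}(R)`, given by `wittToQWittAt` on Witt
vectors and by `q ↦ q ^ d`. -/
noncomputable def cycFrob : QWitt m R →+* QWittAt d (d * m) R :=
  QWitt.lift (wittToQWittAt R d m) (algebraMap ℤ[X] _ (X ^ d))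
    (fun e he x => by
      rw [← map_pow, ← pow_mul, ← map_one (algebraMap ℤ[X] _), ← map_sub, ← Algebra.smul_def,
        X_pow_sub_one_smul_wittToQWittAt he x])
    (fun e f hef hf x => by
      rw [← map_pow, ← pow_mul, ← map_qInt, ← Algebra.smul_def, qInt_smul_wittToQWittAt hef hf x])

variable {R}

theorem cycFrob_mk_C (x : BigWitt m R) :
    cycFrob R d m (Ideal.Quotient.mk _ (C x)) = wittToQWittAt R d m x := by
  simp [cycFrob, QWitt.lift]

theorem cycFrob_mk_X : cycFrob R d m (Ideal.Quotient.mk _ X) = Ideal.Quotient.mk _ (X ^ d) := by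
  rw [cycFrob, QWitt.lift, Ideal.Quotient.lift_mk, coe_eval₂RingHom, eval₂_X]
  exact congrArg (Ideal.Quotient.mk _) (by simp [Polynomial.algebraMap_def])

theorem map_comp_cycFrob {S : Type u} [CommRing S] (f : R →+* S) :
    (QWittAt.map d (d * m) f).comp (cycFrob R d m) = (cycFrob S d m).comp (QWitt.map m f) := by
  refine Ideal.Quotient.ringHom_ext (Polynomial.ringHom_ext (fun x => ?_) ?_)
  · obtain ⟨x, rfl⟩ := truncFun_surjective (dvd_mul_left m d) x
    have htrunc : BigWitt.map m f (truncFun m x) = truncFun m (BigWitt.map (d * m) f x) :=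
      mapFun_truncFun f x
    simp only [RingHom.comp_apply, QWitt.map, QWittAt.map, Ideal.quotientMap_mk, coe_mapRingHom,
      map_C, cycFrob_mk_C, wittToQWittAt_truncFun, htrunc, QWittAt.ofWitt]
  · simp only [RingHom.comp_apply, QWitt.map, QWittAt.map, Ideal.quotientMap_mk, coe_mapRingHom,
      map_X, cycFrob_mk_X, Polynomial.map_pow]

variable (R)

theorem qGhostAt_comp_cycFrob :
    (qGhostAt R d (d * m)).comp (cycFrob R d m) = (ghostFrob R d m).comp (qGhost R m) := by
  refine Ideal.Quotient.ringHom_ext (Polynomial.ringHom_ext (fun x => ?_) ?_)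
  · obtain ⟨x, rfl⟩ := truncFun_surjective (dvd_mul_left m d) x
    funext ⟨e, hde, he⟩
    obtain ⟨e, rfl⟩ := hde
    have hem : e ∣ m := Nat.dvd_of_mul_dvd_mul_left (NeZero.pos d) he
    have hde : d * e / d = e := Nat.mul_div_cancel_left _ (NeZero.pos d)
    simp only [RingHom.comp_apply, cycFrob_mk_C, wittToQWittAt_truncFun, QWittAt.ofWitt, qGhostAt,
      qGhost, ghostFrob, cycSubst, Ideal.Quotient.lift_mk, RingHom.pi_apply, Pi.evalRingHom_apply,
      preQGhost_C, Ideal.quotientMap_mk]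
    rw [ghost_truncFun _ (Nat.div_dvd_of_dvd (by rwa [hde])), Nat.mul_div_mul_left _ _
      (NeZero.pos d), hde]
    simp
  · funext e
    rw [RingHom.comp_apply, RingHom.comp_apply, RingHom.comp_apply, RingHom.comp_apply,
      cycFrob_mk_X]
    simp [qGhostAt, qGhost, ghostFrob, cycSubst, preQGhost]

end Existence

section Injectivity

variable {σ : Type u}

/-- The largest `e ∣ m` for which the monomial `T ^ s` is an `e`-th power. -/
noncomputable def exponentGcd (m : ℕ) (s : σ →₀ ℕ) : ℕ := m.gcd (s.support.gcd s)

/-- The exponent `s / e` of the `e`-th root of the monomial `T ^ s`, meaningful only if `e` divides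
all values of `s`. -/
noncomputable def exponentRoot (e : ℕ) (s : σ →₀ ℕ) : σ →₀ ℕ :=
  s.mapRange (· / e) (Nat.zero_div e)

theorem dvd_exponentGcd_iff {m e : ℕ} {s : σ →₀ ℕ} :
    e ∣ exponentGcd m s ↔ e ∣ m ∧ ∀ i, e ∣ s i := by
  rw [exponentGcd, Nat.dvd_gcd_iff, Finset.dvd_gcd_iff]
  refine and_congr_right fun _ => ⟨fun h i => ?_, fun h i _ => h i⟩
  by_cases hi : i ∈ s.support
  · exact h i hi
  · exact Finsupp.notMem_support_iff.1 hi ▸ dvd_zero e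

theorem exponentGcd_dvd (m : ℕ) (s : σ →₀ ℕ) : exponentGcd m s ∣ m := Nat.gcd_dvd_left _ _

theorem exponentGcd_pos {m : ℕ} [NeZero m] (s : σ →₀ ℕ) : 0 < exponentGcd m s :=
  Nat.gcd_pos_of_pos_left _ (NeZero.pos m)

theorem smul_exponentRoot {m e : ℕ} {s : σ →₀ ℕ} (h : e ∣ exponentGcd m s) :
    e • exponentRoot e s = s := by
  ext i
  exact Nat.mul_div_cancel' ((dvd_exponentGcd_iff.1 h).2 i)

theorem exponentRoot_smul {e : ℕ} (he : 0 < e) (t : σ →₀ ℕ) : exponentRoot e (e • t) = t := by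
  ext i
  exact Nat.mul_div_cancel_left _ he

theorem smul_exponentRoot_exponentGcd {m e : ℕ} (he : 0 < e) {s : σ →₀ ℕ}
    (h : e ∣ exponentGcd m s) :
    (exponentGcd m s / e) • exponentRoot (exponentGcd m s) s = exponentRoot e s := by
  conv_rhs =>
    rw [← smul_exponentRoot (dvd_refl (exponentGcd m s)), ← Nat.mul_div_cancel' h, mul_smul]
  rw [exponentRoot_smul he, Nat.mul_div_cancel' h]

theorem closure_range_monomial_one :
    AddSubgroup.closure (Set.range fun t : σ →₀ ℕ => MvPolynomial.monomial t (1 : ℤ)) = ⊤ := by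
  refine (AddSubgroup.eq_top_iff' _).2 fun p => ?_
  rw [← MvPolynomial.support_sum_monomial_coeff p]
  refine AddSubgroup.sum_mem _ fun t _ => ?_
  rw [← mul_one (p.coeff t), ← smul_eq_mul, ← MvPolynomial.smul_monomial]
  exact AddSubgroup.zsmul_mem _ (AddSubgroup.subset_closure (Set.mem_range_self t)) _

theorem dvd_of_prime_of_dvd_mul_C {A : Type u} [CommRing A] [IsDomain A] {p q : A[X]}
    (hp : Prime p) (hdeg : 0 < p.natDegree) {a : A} (ha : a ≠ 0) (h : p ∣ q * C a) : p ∣ q := by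
  refine (hp.dvd_or_dvd h).resolve_right fun hpa => hdeg.not_ge ?_
  simpa only [natDegree_C] using natDegree_le_of_dvd hpa (C_ne_zero.2 ha)

theorem prod_cyclotomic_dvd {s : Finset ℕ} (hs : ∀ k ∈ s, 0 < k) {p : ℤ[X]}
    (h : ∀ k ∈ s, cyclotomic k ℤ ∣ p) : ∏ k ∈ s, cyclotomic k ℤ ∣ p := by
  refine Finset.prod_dvd_of_isRelPrime (fun i hi j hj hij => ?_) h
  refine (cyclotomic.irreducible (hs i hi)).isRelPrime_iff_not_dvd.2 fun hdvd => hij ?_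
  have hassoc := (cyclotomic.irreducible (hs i hi)).associated_of_dvd
    (cyclotomic.irreducible (hs j hj)) hdvd
  exact cyclotomic_injective
    (eq_of_monic_of_associated (cyclotomic.monic i ℤ) (cyclotomic.monic j ℤ) hassoc)

section Swap

variable {A : Type v} [CommRing A]

/-- The identification of `A[T][X]` with `A[X][T]`, used to compare coefficients of monomials
in `T`. -/
noncomputable def polySwap (σ : Type u) (A : Type v) [CommRing A] :
    (MvPolynomial σ A)[X] →+* MvPolynomial σ A[X] :=
  eval₂RingHom (MvPolynomial.map C) (MvPolynomial.C X)

theorem polySwap_map_C (p : A[X]) : polySwap σ A (p.map MvPolynomial.C) = MvPolynomial.C p := by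
  have h : (polySwap σ A).comp (mapRingHom MvPolynomial.C) = MvPolynomial.C :=
    Polynomial.ringHom_ext (fun a => by simp [polySwap]) (by simp [polySwap])
  exact RingHom.congr_fun h p

theorem polySwap_C_monomial (r : σ →₀ ℕ) (a : A) :
    polySwap σ A (C (MvPolynomial.monomial r a)) = MvPolynomial.monomial r (C a) := by
  simp [polySwap]

theorem dvd_mul_C_of_dvd_sum {ι : Type*} {s : Finset ι} {p : A[X]} {c : ι → A[X]}
    {r : ι → σ →₀ ℕ} {a : ι → A} (hr : Set.InjOn r {i | a i ≠ 0})
    (h : p.map MvPolynomial.C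
      ∣ ∑ i ∈ s, (c i).map MvPolynomial.C * C (MvPolynomial.monomial (r i) (a i)))
    {i : ι} (hi : i ∈ s) : p ∣ c i * C (a i) := by
  classical
  by_cases hai : a i = 0
  · simp only [hai, C_0, mul_zero, dvd_zero]
  have hcoeff := MvPolynomial.C_dvd_iff_dvd_coeff _ _ |>.1
    (polySwap_map_C (σ := σ) p ▸ map_dvd (polySwap σ A) h) (r i)
  simp only [map_sum, map_mul, polySwap_map_C, polySwap_C_monomial, MvPolynomial.coeff_sum,
    MvPolynomial.coeff_C_mul, MvPolynomial.coeff_monomial] at hcoeff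
  rw [Finset.sum_eq_single_of_mem i hi, if_pos rfl] at hcoeff
  · exact hcoeff
  · intro j _ hji
    by_cases haj : a j = 0
    · rw [haj, C_0, ite_self, mul_zero]
    · rw [if_neg fun hrj => hji (hr haj hai hrj), mul_zero]

end Swap

namespace QWittAt

section Ring

variable {R : Type u} [CommRing R] (d N : ℕ)

theorem span_range_ofWitt : Submodule.span ℤ[X] (Set.range (ofWitt d N R)) = ⊤ := by
  refine eq_top_iff.2 fun b _ => ?_
  obtain ⟨a, rfl⟩ := Ideal.Quotient.mk_surjective b
  induction a using Polynomial.induction_on' with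
  | add p q hp hq =>
    rw [map_add]
    exact Submodule.add_mem _ (hp trivial) (hq trivial)
  | monomial n x =>
    have hmem := Submodule.smul_mem _ (X ^ n : ℤ[X])
      (Submodule.subset_span (Set.mem_range_self (f := ofWitt d N R) x))
    rwa [smul_ofWitt, Polynomial.map_pow, map_X, mul_comm, C_mul_X_pow_eq_monomial] at hmem

variable {d N}

theorem qGhostAt_mk [NeZero N] (a : (BigWitt N R)[X]) (k : {k : ℕ // d ∣ k ∧ k ∣ N}) :
    qGhostAt R d N (Ideal.Quotient.mk _ a) k = preQGhost R N k k.2.2 a :=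
  rfl

theorem qGhostAt_smul [NeZero N] (p : ℤ[X]) (b : QWittAt d N R)
    (k : {k : ℕ // d ∣ k ∧ k ∣ N}) :
    qGhostAt R d N (p • b) k
      = Ideal.Quotient.mk _ (p.map (Int.castRingHom R)) * qGhostAt R d N b k := by
  obtain ⟨a, rfl⟩ := Ideal.Quotient.mk_surjective b
  have hsmul : p • Ideal.Quotient.mk (qWittAtIdeal d N R) a
      = Ideal.Quotient.mk _ (p.map (Int.castRingHom _) * a) :=
    congrArg (Ideal.Quotient.mk _) (Algebra.smul_def p a)
  rw [hsmul, qGhostAt_mk, qGhostAt_mk, map_mul, preQGhost, RingHom.comp_apply, coe_mapRingHom,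
    Polynomial.map_map, RingHom.ext_int (RingHom.comp _ _) (Int.castRingHom R)]

end Ring

variable (d m : ℕ)

/-- The generator of the `ℤ[q]`-module `q-W_{dm}^{(d)}(ℤ[T])` attached to the monomial `T ^ s`:
the Verschiebung of the Teichmüller representative of its `g`-th root, with `g` as large as
possible. -/
noncomputable def monomialGen (s : σ →₀ ℕ) : QWittAt d (d * m) (MvPolynomial σ ℤ) :=
  ofWitt d (d * m) _ (verschiebung (d * m)
    (single (d * exponentGcd m s) 1 (MvPolynomial.monomial (exponentRoot (exponentGcd m s) s) 1)))

variable {d m}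

variable [NeZero d]

theorem smul_monomialGen_eq_zero {p : ℤ[X]} {s : σ →₀ ℕ}
    (hp : ∀ e, e ∣ exponentGcd m s → cyclotomic (d * e) ℤ ∣ p) : p • monomialGen d m s = 0 := by
  have hdvd : ∏ k ∈ (d * exponentGcd m s).divisors with d ∣ k, cyclotomic k ℤ ∣ p := by
    refine prod_cyclotomic_dvd (fun k hk => Nat.pos_of_mem_divisors (Finset.mem_filter.1 hk).1)
      fun k hk => ?_
    obtain ⟨hk, e, rfl⟩ := Finset.mem_filter.1 hk
    exact hp e (Nat.dvd_of_mul_dvd_mul_left (NeZero.pos d) (Nat.dvd_of_mem_divisors hk))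
  obtain ⟨r, rfl⟩ := exists_eq_mul_left_of_dvd hdvd
  rw [mul_smul, monomialGen,
    prod_cyclotomic_smul_verschiebung (mul_dvd_mul_left d (exponentGcd_dvd m s)), smul_zero]

variable [NeZero m]

-- The monomial `T ^ t` is the root of order `e` of `T ^ (e t)`, so `V[T ^ t]` is a multiple of the
-- generator attached to `T ^ (e t)`.
theorem verschiebung_monomial_mem_span {e : ℕ} (he : e ∣ d * m) (t : σ →₀ ℕ) :
    ofWitt d (d * m) _ (verschiebung (d * m) (single e 1 (MvPolynomial.monomial t 1)))
      ∈ Submodule.span ℤ[X] (Set.range (monomialGen (σ := σ) d m)) := by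
  by_cases hde : d ∣ e
  · obtain ⟨e, rfl⟩ := hde
    have hem : e ∣ m := Nat.dvd_of_mul_dvd_mul_left (NeZero.pos d) he
    have he0 : 0 < e := Nat.pos_of_dvd_of_pos hem (NeZero.pos m)
    have hroot : e ∣ exponentGcd m (e • t) :=
      dvd_exponentGcd_iff.2 ⟨hem, fun i => dvd_mul_right e (t i)⟩
    have : NeZero (exponentGcd m (e • t)) := ⟨(exponentGcd_pos _).ne'⟩
    have hgen := qInt_smul_verschiebung (dvd_mul_right d e) (mul_dvd_mul_left d hroot)
      (mul_dvd_mul_left d (exponentGcd_dvd m (e • t)))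
      (single _ 1 (MvPolynomial.monomial (exponentRoot (exponentGcd m (e • t)) (e • t)) (1 : ℤ)))
    rw [frobenius_single_one (mul_dvd_mul_left d hroot), MvPolynomial.monomial_pow, one_pow,
      Nat.mul_div_mul_left _ e (NeZero.pos d), smul_exponentRoot_exponentGcd he0 hroot,
      exponentRoot_smul he0] at hgen
    rw [← hgen]
    exact Submodule.smul_mem _ _ (Submodule.subset_span ⟨e • t, rfl⟩)
  · rw [ofWitt_verschiebung_of_not_dvd he hde]
    exact Submodule.zero_mem _

theorem span_range_monomialGen :
    Submodule.span ℤ[X] (Set.range (monomialGen (σ := σ) d m)) = ⊤ := by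
  refine eq_top_iff.2 ((span_range_ofWitt d (d * m)).symm.le.trans (Submodule.span_le.2 ?_))
  suffices h : (⊤ : AddSubgroup (BigWitt (d * m) (MvPolynomial σ ℤ)))
      ≤ (Submodule.span ℤ[X] (Set.range (monomialGen d m))).toAddSubgroup.comap
        (ofWitt d (d * m) _).toAddMonoidHom by
    rintro _ ⟨x, rfl⟩
    exact h (AddSubgroup.mem_top x)
  rw [← closure_single closure_range_monomial_one, AddSubgroup.closure_le]
  rintro _ ⟨n, hn, _, ⟨t, rfl⟩, rfl⟩
  rw [← Nat.div_div_self hn (NeZero.ne _), ← verschiebung_single (Nat.div_dvd_of_dvd hn)]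
  exact verschiebung_monomial_mem_span (Nat.div_dvd_of_dvd hn) t

theorem qGhostAt_monomialGen (s : σ →₀ ℕ) {e : ℕ} (he : e ∣ m) :
    qGhostAt _ d (d * m) (monomialGen d m s)
        ⟨d * e, dvd_mul_right d e, mul_dvd_mul_left d he⟩
      = Ideal.Quotient.mk _ (C (MvPolynomial.monomial (exponentRoot e s)
          (if e ∣ exponentGcd m s then ((m / exponentGcd m s : ℕ) : ℤ) else 0))) := by
  have hg := mul_dvd_mul_left d (exponentGcd_dvd m s)
  have : NeZero (exponentGcd m s) := ⟨(exponentGcd_pos s).ne'⟩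
  rw [monomialGen, ofWitt, RingHom.comp_apply, qGhostAt_mk]
  split_ifs with h
  · have he0 : 0 < e := Nat.pos_of_dvd_of_pos he (NeZero.pos m)
    rw [preQGhost_verschiebung _ _ _ hg _ (mul_dvd_mul_left d h),
      ghost_single _ _ (Nat.div_dvd_of_dvd (mul_dvd_mul_left d h)), if_pos (one_dvd _),
      Nat.cast_one, one_mul, Nat.div_one,
      Nat.mul_div_mul_left _ _ (NeZero.pos d), Nat.mul_div_mul_left _ _ (NeZero.pos d),
      MvPolynomial.monomial_pow, one_pow, smul_exponentRoot_exponentGcd he0 h,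
      ← map_natCast (Ideal.Quotient.mk _), ← map_mul, ← map_natCast C, ← C_mul,
      ← map_natCast MvPolynomial.C, MvPolynomial.C_mul_monomial, mul_one]
  · rw [preQGhost_verschiebung_of_not_dvd _ _ _ hg _ fun h' => h
      (Nat.dvd_of_mul_dvd_mul_left (NeZero.pos d) h'), map_zero, C_0, map_zero]

theorem cyclotomic_dvd_of_qGhostAt_sum_eq_zero {c : (σ →₀ ℕ) →₀ ℤ[X]}
    (hc : qGhostAt _ d (d * m) (c.sum fun s p => p • monomialGen d m s) = 0) (s : σ →₀ ℕ) {e : ℕ}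
    (he : e ∣ exponentGcd m s) : cyclotomic (d * e) ℤ ∣ c s := by
  by_cases hs : s ∈ c.support
  swap
  · exact Finsupp.notMem_support_iff.1 hs ▸ dvd_zero _
  have hem : e ∣ m := he.trans (exponentGcd_dvd m s)
  have hpos : 0 < d * e := Nat.mul_pos (NeZero.pos d) (Nat.pos_of_dvd_of_pos hem (NeZero.pos m))
  have hsum := congrFun hc ⟨d * e, dvd_mul_right d e, mul_dvd_mul_left d hem⟩
  simp only [Finsupp.sum, map_sum, Finset.sum_apply, qGhostAt_smul,
    qGhostAt_monomialGen _ hem, ← map_mul] at hsum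
  rw [← map_sum, Pi.zero_apply, Ideal.Quotient.eq_zero_iff_mem, Ideal.mem_span_singleton,
    ← map_cyclotomic_int, RingHom.ext_int (Int.castRingHom _) MvPolynomial.C] at hsum
  have hinj : Set.InjOn (exponentRoot (σ := σ) e)
      {t | (if e ∣ exponentGcd m t then ((m / exponentGcd m t : ℕ) : ℤ) else 0) ≠ 0} := by
    intro t ht t' ht' heq
    rw [← smul_exponentRoot (ite_ne_right_iff.1 ht).1, heq,
      smul_exponentRoot (ite_ne_right_iff.1 ht').1]
  have hdvd := dvd_mul_C_of_dvd_sum hinj hsum hs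
  rw [if_pos he] at hdvd
  refine dvd_of_prime_of_dvd_mul_C (cyclotomic.irreducible hpos).prime ?_ ?_ hdvd
  · rw [natDegree_cyclotomic]
    exact Nat.totient_pos.2 hpos
  · exact Int.natCast_ne_zero.2 (div_pos_of_dvd (exponentGcd_dvd m s)).ne'

variable (d m)

theorem qGhostAt_injective : Function.Injective (qGhostAt (MvPolynomial σ ℤ) d (d * m)) := by
  refine (injective_iff_map_eq_zero _).2 fun b hb => ?_
  obtain ⟨c, rfl⟩ := (Finsupp.mem_span_range_iff_exists_finsupp (R := ℤ[X])).1
    (span_range_monomialGen (σ := σ) (d := d) (m := m) ▸ Submodule.mem_top (x := b))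
  exact Finset.sum_eq_zero fun s _ => smul_monomialGen_eq_zero fun _ he =>
    cyclotomic_dvd_of_qGhostAt_sum_eq_zero hb s he

end QWittAt

end Injectivity

end PolynomialAction

theorem QWitt.map_surjective (m : ℕ) {R S : Type u} [CommRing R] [CommRing S] {f : R →+* S}
    (hf : Function.Surjective f) : Function.Surjective (QWitt.map m f) :=
  Ideal.quotientMap_surjective (Polynomial.map_surjective _ (mapFun_surjective hf))

theorem mainTheorem8 (d m : ℕ) [NeZero d] [NeZero m] :
    ∃! Frob : (R : Type u) → [CommRing R] → (QWitt m R →+* QWittAt d (d * m) R),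
      (∀ (R S : Type u) [CommRing R] [CommRing S] (f : R →+* S),
        (QWittAt.map d (d * m) f).comp (Frob R) = (Frob S).comp (QWitt.map m f)) ∧
      (∀ (R : Type u) [CommRing R],
        (qGhostAt R d (d * m)).comp (Frob R) = (ghostFrob R d m).comp (qGhost R m)) := by
  refine ⟨fun R _ => cycFrob R d m, ⟨fun R S _ _ f => map_comp_cycFrob d m f,
    fun R _ => qGhostAt_comp_cycFrob R d m⟩, fun Frob ⟨hnat, hghost⟩ => ?_⟩
  funext R _
  have hA : Frob (MvPolynomial R ℤ) = cycFrob (MvPolynomial R ℤ) d m := by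
    refine RingHom.ext fun x => QWittAt.qGhostAt_injective d m ?_
    exact RingHom.congr_fun ((hghost _).trans (qGhostAt_comp_cycFrob _ d m).symm) x
  rw [← RingHom.cancel_right (QWitt.map_surjective m (cover_surjective R)), ← hnat,
    ← map_comp_cycFrob, hA]
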